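/- Let $1<p<\infty$, let $q=p/(p-1)$ and $p^*=\max\{p,q\}$. Let $\mu$ be a probability measure and let $(f_n)_{n=1}^\infty$ be a symmetric $\{-1,0,1\}$-valued martingale difference sequence in real $L_p(\mu)$ with non-zero terms, that is, $\mathbb E(f_n\mid f_1,\dots,f_{n-1})=0$ for all $n\ge 2$ and each $f_n$ has the same distribution as $-f_n$. Let $X=[(f_n)_{n=1}^\infty]$ be its closed linear span in $L_p(\mu)$. Write $\langle f,g\rangle=\int fg\,d\mu$ and $f_n^*(x)=\|f_n\|_2^{-2}\langle f_n,x\rangle$ for $x\in X$. By an operator on $X$ we mean a bounded linear map $X\to X$; the diagonal entries of an operator $T$ are the numbers $f_n^*(Tf_n)$, and $T$ is diagonal if $f_m^*(Tf_n)=0$ for all $m\neq n$. Let $C\ge 1$. A subspace of $L_p(\mu)$ is called $C$-orthogonally complemented if it equals the $L_p$-closure of $P(L_2(\mu)\cap L_p(\mu))$ for some orthogonal projection $P$ of $L_2(\mu)$ with $\|Pf\|_p\le C\|f\|_p$ for all $f\in L_2(\mu)\cap L_p(\mu)$. A linear map $J:X\to L_p(\mu)$ is a distributional embedding if $Jx$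 and $x$ have the same distribution for all $x\in X$. When $X$ is $C$-orthogonally complemented, the formal adjoint of such a $J$ is the unique bounded linear operator $J^\dagger:L_p(\mu)\to X$ with $\langle g,J^\dagger h\rangle=\langle Jg,h\rangle$ for all $h\in L_p(\mu)$ and $g\in X\cap L_q(\mu)$. For operators $T,R$ on $X$ and $\eta>0$, $T$ is an orthogonal factor of $R$ with error $\eta$ if there is a distributional embedding $J:X\to L_p(\mu)$ with $J(X)\subseteq X$ and $\|J^\dagger TJ-R\|\le\eta$. Assume that (a) $X$ is $C$-orthogonally complemented, and (b) for every $\eta>0$ and every operator $T:X\to X$ there exists a diagonal operator $R:X\to X$, all of whose diagonal entries lie in the convex hull of $\{f_n^*(Tf_n):n\in\mathbb N\}$, such that $T$ is an orthogonal factor of $R$ with error $\eta$. Then, for every $0<\epsilon<1$, every $\delta>0$ and every operator $T:X\to X$ with $\inf_{n}|f_n^*(Tf_n)|\ge\delta$, there are operators $A,B:X\to X$ such that $$ATB=\mathrm{id}_X\quad\text{and}\quad \|A\|\,\|B\|\le C(p^*-1)(1-\epsilon)^{-1}\delta^{-1}.$$ In particular, $(f_n)_{n=1}^\infty$, which is a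 Schauder basis of $X$ with coordinate functionals $(f_n^*)_{n=1}^\infty$, has the factorization property: every operator $T:X\to X$ with $\inf_n|f_n^*(Tf_n)|>0$ is a factor of $\mathrm{id}_X$, i.e. $\mathrm{id}_X=ATB$ for some operators $A,B:X\to X$. -/

import Mathlib

open MeasureTheory ProbabilityTheory
open scoped ENNReal

noncomputable section

/-! ### Factors of operators and the factorization property of a basis -/

/-- `T` is a factor of `S`: there are bounded linear operators `A, B` with `S = A T B`. -/
def IsFactor {X : Type*} [NormedAddCommGroup X] [NormedSpace ℝ X] (T S : X →L[ℝ] X) : Prop :=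
  ∃ A B : X →L[ℝ] X, S = A ∘L T ∘L B

/-- `T` is a `K`-factor of `S`: there are bounded linear operators `A, B` with `S = A T B` and
`‖A‖ ‖B‖ ≤ K`. -/
def IsKFactor {X : Type*} [NormedAddCommGroup X] [NormedSpace ℝ X] (K : ℝ)
    (T S : X →L[ℝ] X) : Prop :=
  ∃ A B : X →L[ℝ] X, S = A ∘L T ∘L B ∧ ‖A‖ * ‖B‖ ≤ K

/-- A Schauder basis `b` has the factorization property: every bounded operator `T` with
`infₙ |bₙ*(T bₙ)| ≥ δ` for some `δ > 0` is a factor of the identity. -/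
def HasFactorizationProperty {X : Type*} [NormedAddCommGroup X] [NormedSpace ℝ X]
    (b : SchauderBasis ℝ X) : Prop :=
  ∀ T : X →L[ℝ] X, (∃ δ : ℝ, 0 < δ ∧ ∀ n, δ ≤ |b.coord n (T (b n))|) →
    IsFactor T (ContinuousLinearMap.id ℝ X)

section Lp

variable {Ω : Type*} [MeasurableSpace Ω] {μ : Measure Ω}
variable {Ω' : Type*} [MeasurableSpace Ω'] {ν : Measure Ω'}
variable {p : ℝ≥0∞} [Fact (1 ≤ p)]

/-- The pairing `⟨f, g⟩ = ∫ f g dμ`. -/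
def pairing (μ : Measure Ω) (f g : Ω → ℝ) : ℝ := ∫ ω, f ω * g ω ∂μ

/-! ### Orthogonally complemented subspaces -/

/-- An operator `P` on `L₂(μ)` is an orthogonal projection (a self-adjoint idempotent) which is
`p`-`C`-bounded: `‖P f‖_p ≤ C ‖f‖_p` for every `f ∈ L₂(μ) ∩ L_p(μ)`. -/
def IsPBoundedOrthProjection (p : ℝ≥0∞) (C : ℝ) (P : Lp ℝ 2 μ →L[ℝ] Lp ℝ 2 μ) : Prop :=
  IsStarProjection P ∧
    ∀ f : Lp ℝ 2 μ, MemLp f p μ → eLpNorm (P f) p μ ≤ ENNReal.ofReal C * eLpNorm f p μ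

/-- `X ⊆ L_p(μ)` is `C`-orthogonally complemented: `X` is the `L_p`-closure of
`P(L₂(μ) ∩ L_p(μ))` for some `p`-`C`-bounded orthogonal projection `P` of `L₂(μ)`. -/
def IsOrthComplemented (C : ℝ) (X : Submodule ℝ (Lp ℝ p μ)) : Prop :=
  ∃ P : Lp ℝ 2 μ →L[ℝ] Lp ℝ 2 μ, IsPBoundedOrthProjection p C P ∧
    (X : Set (Lp ℝ p μ)) =
      closure {g : Lp ℝ p μ | ∃ f : Lp ℝ 2 μ, MemLp f p μ ∧ g =ᵐ[μ] P f}

/-! ### Distributional embeddings, formal adjoints and orthogonal factors -/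

/-- `T : Y → L_p(μ)`, for `Y ⊆ L_p(ν)`, is a distributional embedding: `T y` and `y` have the same
distribution for every `y ∈ Y`. (Such a linear map is an isometry, hence automatically bounded.) -/
def IsDistEmbedding {Y : Submodule ℝ (Lp ℝ p ν)} (T : Y →L[ℝ] Lp ℝ p μ) : Prop :=
  ∀ y : Y, IdentDistrib (T y : Ω → ℝ) ((y : Lp ℝ p ν) : Ω' → ℝ) μ ν

/-- `S : L_p(μ) → Y` is formally adjoint to `T : Y → L_p(μ)`, where `Y ⊆ L_p(ν)`:
`⟨g, S f⟩ = ⟨T g, f⟩` for all `f ∈ L_p(μ)` and `g ∈ Y ∩ L_q(ν)`.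

If `Y` is the closure of `P(L₂ ∩ L_p)` for a `p`-bounded orthogonal projection `P`, and `Y'`
is the `L_q`-closure of `P(L₂ ∩ L_q)`, then `Y ∩ L_q(ν) = Y ∩ Y'`, which is dense in `Y'`, and
`Y'` is the dual of `Y` under the pairing. So for a distributional embedding `T` there is exactly
one such `S`: the adjoint of the extension of `T` to `Y' → L_q(μ)`. -/
def IsFormalAdjoint (q : ℝ≥0∞) {Y : Submodule ℝ (Lp ℝ p ν)} (T : Y →L[ℝ] Lp ℝ p μ)
    (S : Lp ℝ p μ →L[ℝ] Y) : Prop :=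
  ∀ (f : Lp ℝ p μ) (g : Y), MemLp ((g : Lp ℝ p ν) : Ω' → ℝ) q ν →
    pairing ν (g : Lp ℝ p ν) (S f : Lp ℝ p ν) = pairing μ (T g) f

open Classical in
/-- The formal adjoint `T† : L_p(μ) → Y` of a distributional embedding `T : Y → L_p(μ)` of an
orthogonally complemented subspace `Y ⊆ L_p(ν)`; `q` is the conjugate exponent of `p`.
(The value `0` is used only for maps `T` that have no formal adjoint.) -/
def formalAdjoint (q : ℝ≥0∞) {Y : Submodule ℝ (Lp ℝ p ν)} (T : Y →L[ℝ] Lp ℝ p μ) :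
    Lp ℝ p μ →L[ℝ] Y :=
  if h : ∃ S : Lp ℝ p μ →L[ℝ] Y, IsFormalAdjoint q T S then h.choose else 0

/-- For bounded operators `R` on `X ⊆ L_p(μ)` and `S` on an orthogonally complemented
`Y ⊆ L_p(ν)`: `R` is an orthogonal factor of `S` with error `ε` if there is a distributional
embedding `T : Y → L_p(μ)` with `T(Y) ⊆ X` and `‖T† R T - S‖ ≤ ε`. -/
def IsOrthFactor (q : ℝ≥0∞) (ε : ℝ) {X : Submodule ℝ (Lp ℝ p μ)} {Y : Submodule ℝ (Lp ℝ p ν)}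
    (R : X →L[ℝ] X) (S : Y →L[ℝ] Y) : Prop :=
  ∃ (T : Y →L[ℝ] Lp ℝ p μ) (hTX : ∀ y, T y ∈ X), IsDistEmbedding T ∧
    ‖formalAdjoint q T ∘L X.subtypeL ∘L R ∘L T.codRestrict X hTX - S‖ ≤ ε

/-! ### Symmetric three-valued martingale difference sequences -/

/-- `(fₙ)` is a martingale difference sequence: `E(f_{n+1} | f_0, …, f_n) = 0` for all `n ≥ 0`.
There is no condition on the first term. -/
def IsMDS (f : ℕ → Lp ℝ p μ) : Prop :=
  ∀ n, μ[(f (n + 1) : Ω → ℝ) | ⨆ i ≤ n, MeasurableSpace.comap (f i : Ω → ℝ) inferInstance]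
    =ᵐ[μ] 0

/-- A symmetric `{-1,0,1}`-valued martingale difference sequence with non-zero terms. -/
structure IsSymmThreeValuedMDS (f : ℕ → Lp ℝ p μ) : Prop where
  mds : IsMDS f
  symm : ∀ n, IdentDistrib (f n : Ω → ℝ) (fun ω => -f n ω) μ μ
  values : ∀ n, ∀ᵐ ω ∂μ, f n ω = -1 ∨ f n ω = 0 ∨ f n ω = 1
  ne_zero : ∀ n, f n ≠ 0

/-- The closed linear span `[(fₙ)]` in `L_p(μ)`. -/
def closedSpan (f : ℕ → Lp ℝ p μ) : Submodule ℝ (Lp ℝ p μ) :=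
  (Submodule.span ℝ (Set.range f)).topologicalClosure

/-- `fₙ` as an element of `[(fₙ)]`. -/
def gen (f : ℕ → Lp ℝ p μ) (n : ℕ) : closedSpan f :=
  ⟨f n, Submodule.le_topologicalClosure _ (Submodule.subset_span ⟨n, rfl⟩)⟩

/-- The coordinate functional `fₙ*(x) = ‖fₙ‖₂⁻² ⟨fₙ, x⟩`. -/
def coordFn (f : ℕ → Lp ℝ p μ) (n : ℕ) (x : closedSpan f) : ℝ :=
  (pairing μ (f n) (f n))⁻¹ * pairing μ (f n) (x : Lp ℝ p μ)

/-- `R` is diagonal with respect to `(fₙ)`: `fₘ*(R fₙ) = 0` for `m ≠ n`. -/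
def IsDiagonal (f : ℕ → Lp ℝ p μ) (R : closedSpan f →L[ℝ] closedSpan f) : Prop :=
  ∀ m n, m ≠ n → coordFn f m (R (gen f n)) = 0

/-- The `n`-th diagonal entry `fₙ*(T fₙ)`. -/
def diagEntry (f : ℕ → Lp ℝ p μ) (T : closedSpan f →L[ℝ] closedSpan f) (n : ℕ) : ℝ :=
  coordFn f n (T (gen f n))

end Lp

end

/-! Write `r` for `max p q`. The point is that multipliers along the sequence are bounded with the
sharp constant `r - 1`, so the diagonal of an operator can be normalised before hypothesis (b) is
used.

Given `T` with diagonal entries of modulus at least `δ`, let `D` be the multiplier by their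
reciprocals; Burkholder's inequality gives `‖D‖ ≤ (r - 1) / δ`. Every diagonal entry of `T D` is
`1`, so the convex hull in (b) is `{1}` and the diagonal operator supplied there must be the
identity. Hence `J† T D J` is within `ε` of the identity for some distributional embedding `J`, and
a Neumann inverse `V` with `‖V‖ ≤ 1 / (1 - ε)` gives the factorization with `A = V J†` and `B = D
J`. Here `J` is an isometry and `‖J†‖ ≤ C`.

Two estimates carry the weight. For multipliers (`IsSymmThreeValuedMDS.exists_multiplier`),
Burkholder's function is midpoint concave along the directions `(1, 1)` and `(1, -1)`, so its
integral along a martingale and its sign transform never increases; it also majorizes `|y|^p - (r -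
1)^p |x|^p` up to a constant. Sign transforms extend to multipliers in `[-1, 1]` by convexity, then
to the closed span by density; 0/1 multipliers also yield the Schauder basis. For the adjoint
(`IsFormalAdjoint.norm_le`), self-adjointness of the projection transfers its bound from `L_p` to
`L_q`, and `J` preserves `L_q` norms because it preserves distributions. -/

/-! ### The Burkholder function -/

/-- The zigzag form of Burkholder's function. -/
noncomputable def burkholderFun (p r s d : ℝ) : ℝ :=
  (|s - d| - (r - 1) * |s + d|) * max |s| |d| ^ (p - 1)

/-- The second derivative is `(p - 1) t ^ (p - 3) (A p t + B (p - 2))`, whose sign is `h2`; `h1`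
says that the derivative is nonnegative at the left endpoint, and convexity propagates this. -/
theorem convexOn_monotoneOn_rpow_combination {p A B E K d : ℝ} (hp : 1 < p) (hd : 0 < d)
    (h2 : ∀ t, d ≤ t → 0 ≤ A * p * t + B * (p - 2))
    (h1 : 0 ≤ A * p * d ^ (p - 1) + B * (p - 1) * d ^ (p - 2) + E) :
    ConvexOn ℝ (Set.Ici d) (fun t : ℝ => A * t ^ p + B * t ^ (p - 1) + E * t + K) ∧
      MonotoneOn (fun t : ℝ => A * t ^ p + B * t ^ (p - 1) + E * t + K) (Set.Ici d) := by
  have hder : ∀ t : ℝ, 0 < t → HasDerivAt (fun t : ℝ => A * t ^ p + B * t ^ (p - 1) + E * t + K)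
      (A * p * t ^ (p - 1) + B * (p - 1) * t ^ (p - 2) + E) t := by
    intro t ht
    have e1 := (Real.hasDerivAt_rpow_const (x := t) (p := p) (Or.inl ht.ne')).const_mul A
    have e2 := (Real.hasDerivAt_rpow_const (x := t) (p := p - 1) (Or.inl ht.ne')).const_mul B
    have e3 := (hasDerivAt_id t).const_mul E
    refine (((e1.add e2).add e3).add_const K).congr_deriv ?_
    rw [show p - 1 - 1 = p - 2 by ring]; ring
  have hder2 : ∀ t : ℝ, 0 < t →
      HasDerivAt (fun t : ℝ => A * p * t ^ (p - 1) + B * (p - 1) * t ^ (p - 2) + E)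
      ((p - 1) * t ^ (p - 3) * (A * p * t + B * (p - 2))) t := by
    intro t ht
    have e1 := (Real.hasDerivAt_rpow_const (x := t) (p := p - 1) (Or.inl ht.ne')).const_mul (A * p)
    have e2 := (Real.hasDerivAt_rpow_const (x := t) (p := p - 2)
      (Or.inl ht.ne')).const_mul (B * (p - 1))
    refine ((e1.add e2).add_const E).congr_deriv ?_
    rw [show p - 1 - 1 = (p - 3) + 1 by ring, Real.rpow_add_one ht.ne',
      show p - 2 - 1 = p - 3 by ring]
    ring
  have hmono : MonotoneOn (fun t : ℝ => A * p * t ^ (p - 1) + B * (p - 1) * t ^ (p - 2) + E)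
      (Set.Ici d) := by
    refine monotoneOn_of_deriv_nonneg (convex_Ici d)
      (fun t ht => (hder2 t (hd.trans_le ht)).continuousAt.continuousWithinAt)
      (fun t ht => ?_) (fun t ht => ?_)
    · rw [interior_Ici] at ht
      exact (hder2 t (hd.trans ht)).differentiableAt.differentiableWithinAt
    · rw [interior_Ici] at ht
      rw [(hder2 t (hd.trans ht)).deriv]
      have := h2 t (le_of_lt ht)
      have h3 : 0 < t := hd.trans ht
      have : 0 ≤ p - 1 := by linarith
      positivity
  have hcont : ContinuousOn (fun t : ℝ => A * t ^ p + B * t ^ (p - 1) + E * t + K) (Set.Ici d) :=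
    fun t ht => (hder t (hd.trans_le ht)).continuousAt.continuousWithinAt
  have hdiff : DifferentiableOn ℝ (fun t : ℝ => A * t ^ p + B * t ^ (p - 1) + E * t + K)
      (interior (Set.Ici d)) := by
    intro t ht
    rw [interior_Ici] at ht
    exact (hder t (hd.trans ht)).differentiableAt.differentiableWithinAt
  constructor
  · refine MonotoneOn.convexOn_of_deriv (convex_Ici d) hcont hdiff ?_
    intro x hx y hy hxy
    rw [interior_Ici] at hx hy
    rw [(hder x (hd.trans hx)).deriv, (hder y (hd.trans hy)).deriv]
    exact hmono (Set.mem_Ici.2 (le_of_lt hx)) (Set.mem_Ici.2 (le_of_lt hy)) hxy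
  · refine monotoneOn_of_deriv_nonneg (convex_Ici d) hcont hdiff ?_
    intro t ht
    rw [interior_Ici] at ht
    rw [(hder t (hd.trans ht)).deriv]
    exact h1.trans (hmono Set.self_mem_Ici (Set.mem_Ici.2 (le_of_lt ht)) (le_of_lt ht))

/-- A convex increasing function composed with the convex function `max · d` is convex. -/
theorem ConvexOn.midpoint_comp_max {φ : ℝ → ℝ} {d : ℝ} (hc : ConvexOn ℝ (Set.Ici d) φ)
    (hm : MonotoneOn φ (Set.Ici d)) (s h : ℝ) :
    2 * φ (max s d) ≤ φ (max (s + h) d) + φ (max (s - h) d) := by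
  have h1 : max (s + h) d ∈ Set.Ici d := Set.mem_Ici.2 (le_max_right _ _)
  have h2 : max (s - h) d ∈ Set.Ici d := Set.mem_Ici.2 (le_max_right _ _)
  have h3 := hc.2
  replace h3 := h3 h1 h2 (show (0 : ℝ) ≤ 1 / 2 by norm_num) (show (0 : ℝ) ≤ 1 / 2 by norm_num)
    (by norm_num)
  have h4 : max s d ≤ (1 / 2 : ℝ) • max (s + h) d + (1 / 2 : ℝ) • max (s - h) d := by
    simp only [smul_eq_mul]
    refine max_le ?_ ?_ <;>
    linarith [le_max_left (s + h) d, le_max_left (s - h) d, le_max_right (s + h) d,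
      le_max_right (s - h) d]
  have h5 := hm (Set.mem_Ici.2 (le_max_right s d))
    (Set.mem_Ici.2 ((le_max_right s d).trans h4)) h4
  simp only [smul_eq_mul] at h3 h5
  linarith

/-- On `[-d, d]` the function is affine in `s`. Beyond `d` and `-d` it falls below that affine
function by `a s` and `b (-s)`, where `a` and `b` are convex, increasing and zero at `d`. The slopes
at `d` are `2 (p r - p - r) d ^ (p - 1)` and `2 (r - p) d ^ (p - 1)`, which is where `hpr'` and
`hpr` enter. -/
theorem burkholderFun_midpoint_pos {p r d : ℝ} (hp : 1 < p) (hr : 2 ≤ r) (hpr : p ≤ r)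
    (hpr' : p + r ≤ p * r) (hd : 0 < d) (s h : ℝ) :
    burkholderFun p r (s + h) d + burkholderFun p r (s - h) d ≤ 2 * burkholderFun p r s d := by
  have hdp : d ^ (p - 1) = d ^ (p - 2) * d := by
    rw [← Real.rpow_add_one hd.ne']; congr 1; ring
  have hdp' : d ^ p = d ^ (p - 1) * d := by
    rw [← Real.rpow_add_one hd.ne']; congr 1; ring
  have hpos : 0 < d ^ (p - 1) := Real.rpow_pos_of_pos hd _
  obtain ⟨ca, ma⟩ := convexOn_monotoneOn_rpow_combination (p := p) (A := r - 2) (B := r * d)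
    (E := -(r * d ^ (p - 1))) (K := (2 - r) * d ^ p) hp hd
    (fun t ht => by nlinarith [mul_nonneg (sub_nonneg.2 hr) (sub_nonneg.2 ht)])
    (by
      rw [show (r - 2) * p * d ^ (p - 1) + r * d * (p - 1) * d ^ (p - 2) + -(r * d ^ (p - 1))
        = 2 * (p * r - (p + r)) * d ^ (p - 1) by rw [hdp]; ring]
      have := sub_nonneg.2 hpr'
      positivity)
  obtain ⟨cb, mb⟩ := convexOn_monotoneOn_rpow_combination (p := p) (A := r - 2) (B := -(r * d))
    (E := r * d ^ (p - 1)) (K := (2 - r) * d ^ p) hp hd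
    (fun t ht => by
      nlinarith [mul_nonneg (mul_nonneg (sub_nonneg.2 hr) (by linarith : (0 : ℝ) ≤ p))
        (sub_nonneg.2 ht), mul_nonneg hd.le (sub_nonneg.2 hpr)])
    (by
      rw [show (r - 2) * p * d ^ (p - 1) + -(r * d) * (p - 1) * d ^ (p - 2) + r * d ^ (p - 1)
        = 2 * (r - p) * d ^ (p - 1) by rw [hdp]; ring]
      have := sub_nonneg.2 hpr
      positivity)
  set a : ℝ → ℝ := fun t => (r - 2) * t ^ p + r * d * t ^ (p - 1) + -(r * d ^ (p - 1)) * t +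
    (2 - r) * d ^ p with ha
  set b : ℝ → ℝ := fun t => (r - 2) * t ^ p + -(r * d) * t ^ (p - 1) + r * d ^ (p - 1) * t +
    (2 - r) * d ^ p with hb
  have key : ∀ s, burkholderFun p r s d =
      ((2 - r) * d - r * s) * d ^ (p - 1) - a (max s d) - b (max (-s) d) := by
    intro s
    have ha0 : a d = 0 := by simp only [ha]; rw [hdp']; ring
    have hb0 : b d = 0 := by simp only [hb]; rw [hdp']; ring
    unfold burkholderFun
    rw [abs_of_pos hd]
    rcases le_total d s with h1 | h1
    · have hs : 0 < s := hd.trans_le h1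
      have hsp : s ^ p = s ^ (p - 1) * s := by
        rw [← Real.rpow_add_one hs.ne']; congr 1; ring
      rw [abs_of_pos hs, max_eq_left h1, max_eq_right (by linarith : -s ≤ d), hb0,
        abs_of_nonneg (sub_nonneg.2 h1), abs_of_nonneg (by linarith : 0 ≤ s + d)]
      simp only [ha]
      rw [hsp, hdp']; ring
    · rcases le_total (-s) d with h2 | h2
      · rw [max_eq_right h1, max_eq_right h2, ha0, hb0, max_eq_right (abs_le.2 ⟨by linarith, h1⟩),
          abs_of_nonpos (by linarith : s - d ≤ 0), abs_of_nonneg (by linarith : 0 ≤ s + d)]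
        ring
      · have hs : 0 < -s := hd.trans_le h2
        have hsp : (-s) ^ p = (-s) ^ (p - 1) * (-s) := by
          rw [← Real.rpow_add_one hs.ne']; congr 1; ring
        rw [abs_of_neg (by linarith : s < 0), max_eq_left h2, max_eq_right h1, ha0,
          abs_of_nonpos (by linarith : s - d ≤ 0), abs_of_nonpos (by linarith : s + d ≤ 0)]
        simp only [hb]
        rw [hsp, hdp']; ring
  have ea := ca.midpoint_comp_max ma s h
  have eb := cb.midpoint_comp_max mb (-s) h
  rw [key, key, key]
  rw [show -s + h = -(s - h) by ring, show -s - h = -(s + h) by ring] at eb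
  linarith

theorem continuous_burkholderFun {p r : ℝ} (hp : 1 < p) :
    Continuous (fun z : ℝ × ℝ => burkholderFun p r z.1 z.2) := by
  unfold burkholderFun
  refine Continuous.mul (by fun_prop) (Continuous.rpow_const (by fun_prop) ?_)
  intro; right; linarith

theorem burkholderFun_swap (p r s d : ℝ) : burkholderFun p r s d = burkholderFun p r d s := by
  unfold burkholderFun
  rw [abs_sub_comm, add_comm s d, max_comm]

theorem burkholderFun_neg (p r s d : ℝ) : burkholderFun p r (-s) (-d) = burkholderFun p r s d := by
  unfold burkholderFun
  rw [abs_neg, abs_neg, show -s - -d = -(s - d) by ring, show -s + -d = -(s + d) by ring, abs_neg,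
    abs_neg]

theorem burkholderFun_midpoint {p r : ℝ} (hp : 1 < p) (hr : 2 ≤ r) (hpr : p ≤ r)
    (hpr' : p + r ≤ p * r) (d s h : ℝ) :
    burkholderFun p r (s + h) d + burkholderFun p r (s - h) d ≤ 2 * burkholderFun p r s d := by
  -- Negative `d` reduces to positive `d` by the symmetry `(s, d) ↦ (-s, -d)`, and `d = 0` follows
  -- by continuity.
  have hcl : IsClosed {d : ℝ | burkholderFun p r (s + h) d + burkholderFun p r (s - h) d ≤
      2 * burkholderFun p r s d} := by
    have hc : ∀ s : ℝ, Continuous fun d => burkholderFun p r s d := fun s =>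
      (continuous_burkholderFun hp).comp (by fun_prop : Continuous fun d : ℝ => (s, d))
    exact isClosed_le ((hc _).add (hc _)) (continuous_const.mul (hc _))
  have hsub : ({0}ᶜ : Set ℝ) ⊆ {d : ℝ | burkholderFun p r (s + h) d +
      burkholderFun p r (s - h) d ≤ 2 * burkholderFun p r s d} := by
    intro d hd
    rcases lt_or_gt_of_ne (show d ≠ 0 from hd) with h0 | h0
    · have := burkholderFun_midpoint_pos hp hr hpr hpr' (neg_pos.2 h0) (-s) (-h)
      rw [show -s + -h = -(s + h) by ring, show -s - -h = -(s - h) by ring, burkholderFun_neg,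
        burkholderFun_neg, burkholderFun_neg] at this
      exact this
    · exact burkholderFun_midpoint_pos hp hr hpr hpr' h0 s h
  have := closure_minimal hsub hcl
  rw [(dense_compl_singleton (0 : ℝ)).closure_eq] at this
  exact this (Set.mem_univ d)

/-- Zigzag midpoint concavity of Burkholder's function. -/
theorem burkholderFun_zigzag {p r : ℝ} (hp : 1 < p) (hr : 2 ≤ r) (hpr : p ≤ r)
    (hpr' : p + r ≤ p * r) (x y h : ℝ) {e : ℝ} (he : e = 1 ∨ e = -1) :
    burkholderFun p r ((x + h) + (y + e * h)) ((x + h) - (y + e * h)) +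
      burkholderFun p r ((x - h) + (y - e * h)) ((x - h) - (y - e * h)) ≤
    2 * burkholderFun p r (x + y) (x - y) := by
  rcases he with rfl | rfl
  · have := burkholderFun_midpoint hp hr hpr hpr' (x - y) (x + y) (2 * h)
    convert this using 3 <;> ring
  · have := burkholderFun_midpoint hp hr hpr hpr' (x + y) (x - y) (2 * h)
    rw [burkholderFun_swap, add_comm, burkholderFun_swap, add_comm, burkholderFun_swap p r (x + y)]
    convert this using 3 <;> ring

/-! ### The scalar inequality behind the constant `max p q - 1`. -/

/-- The weighted mean `m = (t + (p - 1) b) / p` makes the terms in `m ^ (p - 2)` collapse to `-p t m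
^ (p - 2)`. As `m` lies between `t` and `b`, the sign of the derivative depends only on the signs of
`t - b` and `p - 2`, so `t = b` is a global extremum. -/
theorem hasDerivAt_rpow_sub_tangent {p b t : ℝ} (hp : 1 < p) (hb : 0 ≤ b) (ht : 0 < t) :
    HasDerivAt (fun t : ℝ => t ^ p - b ^ p - p * (t - b) * ((t + (p - 1) * b) / p) ^ (p - 1))
      (p * t * (t ^ (p - 2) - ((t + (p - 1) * b) / p) ^ (p - 2))) t := by
  have hp0 : 0 < p := by linarith
  have hm : 0 < (t + (p - 1) * b) / p := by
    have : 0 ≤ p - 1 := by linarith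
    positivity
  have e1 := (Real.hasDerivAt_rpow_const (x := t) (p := p) (Or.inl ht.ne')).sub_const (b ^ p)
  have e2 : HasDerivAt (fun t : ℝ => (t + (p - 1) * b) / p) (1 / p) t :=
    ((hasDerivAt_id t).add_const _).div_const p
  have e3 := e2.rpow_const (p := p - 1) (Or.inl hm.ne')
  have e4 := (((hasDerivAt_id t).sub_const b).const_mul p).mul e3
  refine (e1.sub e4).congr_deriv ?_
  set m := (t + (p - 1) * b) / p with hmdef
  have hm1 : m ^ (p - 1) = m ^ (p - 2) * m := by
    rw [← Real.rpow_add_one hm.ne']; congr 1; ring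
  have ht1 : t ^ (p - 1) = t ^ (p - 2) * t := by
    rw [← Real.rpow_add_one ht.ne']; congr 1; ring
  rw [show p - 1 - 1 = p - 2 by ring, hm1, ht1]
  simp only [id]
  have h5 : p * m = t + (p - 1) * b := by rw [hmdef]; field_simp
  have h6 : p * (1 / p) = 1 := by field_simp
  linear_combination (-(m ^ (p - 2))) * h5 - (t - b) * (p - 1) * m ^ (p - 2) * h6

theorem continuous_rpow_sub_tangent {p : ℝ} (b : ℝ) (hp : 1 < p) :
    Continuous (fun t : ℝ => t ^ p - b ^ p - p * (t - b) * ((t + (p - 1) * b) / p) ^ (p - 1)) := by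
  have h1 : Continuous fun t : ℝ => t ^ p :=
    Continuous.rpow_const continuous_id fun _ => Or.inr (by linarith)
  have h2 : Continuous fun t : ℝ => ((t + (p - 1) * b) / p) ^ (p - 1) :=
    Continuous.rpow_const (by fun_prop) fun _ => Or.inr (by linarith)
  fun_prop

theorem rpow_sub_rpow_ge_of_two_le {p b t : ℝ} (hp : 2 ≤ p) (hb : 0 ≤ b) (ht : 0 ≤ t) :
    p * (t - b) * ((t + (p - 1) * b) / p) ^ (p - 1) ≤ t ^ p - b ^ p := by
  have hp1 : 1 < p := by linarith
  have hp0 : 0 < p := by linarith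
  have hc := continuous_rpow_sub_tangent b hp1
  rw [← sub_nonneg]
  have h0 : b ^ p - b ^ p - p * (b - b) * ((b + (p - 1) * b) / p) ^ (p - 1) = 0 := by ring
  rcases le_total t b with htb | htb
  · have := antitoneOn_of_deriv_nonpos (convex_Icc 0 b) hc.continuousOn
      (fun t ht => by
        rw [interior_Icc] at ht
        exact (hasDerivAt_rpow_sub_tangent hp1 hb ht.1).differentiableAt.differentiableWithinAt)
      (fun t ht => by
        rw [interior_Icc] at ht
        rw [(hasDerivAt_rpow_sub_tangent hp1 hb ht.1).deriv]
        have hle : t ≤ (t + (p - 1) * b) / p := by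
          rw [le_div_iff₀ hp0]; nlinarith [ht.2]
        exact mul_nonpos_of_nonneg_of_nonpos (by have := ht.1; positivity)
          (sub_nonpos.2 (Real.rpow_le_rpow ht.1.le hle (by linarith))))
    have := this (⟨ht, htb⟩ : t ∈ Set.Icc 0 b) (⟨hb, le_rfl⟩ : b ∈ Set.Icc 0 b) htb
    simp only [h0] at this
    exact this
  · have := monotoneOn_of_deriv_nonneg (convex_Ici b) hc.continuousOn
      (fun t ht => by
        rw [interior_Ici] at ht
        exact (hasDerivAt_rpow_sub_tangent hp1 hb
          (hb.trans_lt ht)).differentiableAt.differentiableWithinAt)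
      (fun t ht => by
        rw [interior_Ici] at ht
        have ht0 : 0 < t := hb.trans_lt ht
        rw [(hasDerivAt_rpow_sub_tangent hp1 hb ht0).deriv]
        have hle : (t + (p - 1) * b) / p ≤ t := by
          rw [div_le_iff₀ hp0]; nlinarith [Set.mem_Ioi.1 ht]
        have hm : 0 ≤ (t + (p - 1) * b) / p := by
          have : 0 ≤ p - 1 := by linarith
          positivity
        exact mul_nonneg (by positivity)
          (sub_nonneg.2 (Real.rpow_le_rpow hm hle (by linarith))))
    have := this (Set.self_mem_Ici) (Set.mem_Ici.2 htb) htb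
    simp only [h0] at this
    exact this

theorem rpow_sub_rpow_le_of_le_two {p b t : ℝ} (hp1 : 1 < p) (hp : p ≤ 2) (hb : 0 ≤ b)
    (ht : 0 ≤ t) :
    t ^ p - b ^ p ≤ p * (t - b) * ((t + (p - 1) * b) / p) ^ (p - 1) := by
  have hp0 : 0 < p := by linarith
  have hc := continuous_rpow_sub_tangent b hp1
  rw [← sub_nonpos]
  have h0 : b ^ p - b ^ p - p * (b - b) * ((b + (p - 1) * b) / p) ^ (p - 1) = 0 := by ring
  rcases le_total t b with htb | htb
  · have := monotoneOn_of_deriv_nonneg (convex_Icc 0 b) hc.continuousOn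
      (fun t ht => by
        rw [interior_Icc] at ht
        exact (hasDerivAt_rpow_sub_tangent hp1 hb ht.1).differentiableAt.differentiableWithinAt)
      (fun t ht => by
        rw [interior_Icc] at ht
        rw [(hasDerivAt_rpow_sub_tangent hp1 hb ht.1).deriv]
        have hle : t ≤ (t + (p - 1) * b) / p := by
          rw [le_div_iff₀ hp0]; nlinarith [ht.2]
        exact mul_nonneg (by have := ht.1; positivity)
          (sub_nonneg.2 (Real.rpow_le_rpow_of_nonpos ht.1 hle (by linarith))))
    have := this (⟨ht, htb⟩ : t ∈ Set.Icc 0 b) (⟨hb, le_rfl⟩ : b ∈ Set.Icc 0 b) htb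
    simp only [h0] at this
    exact this
  · have := antitoneOn_of_deriv_nonpos (convex_Ici b) hc.continuousOn
      (fun t ht => by
        rw [interior_Ici] at ht
        exact (hasDerivAt_rpow_sub_tangent hp1 hb
          (hb.trans_lt ht)).differentiableAt.differentiableWithinAt)
      (fun t ht => by
        rw [interior_Ici] at ht
        have ht0 : 0 < t := hb.trans_lt ht
        rw [(hasDerivAt_rpow_sub_tangent hp1 hb ht0).deriv]
        have hle : (t + (p - 1) * b) / p ≤ t := by
          rw [div_le_iff₀ hp0]; nlinarith [Set.mem_Ioi.1 ht]
        have hm : 0 < (t + (p - 1) * b) / p := by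
          have : 0 ≤ p - 1 := by linarith
          positivity
        exact mul_nonpos_of_nonneg_of_nonpos (by positivity)
          (sub_nonpos.2 (Real.rpow_le_rpow_of_nonpos hm hle (by linarith))))
    have := this (Set.self_mem_Ici) (Set.mem_Ici.2 htb) htb
    simp only [h0] at this
    exact this

theorem exists_rpow_sub_rpow_le {p q : ℝ} (hpq : p.HolderConjugate q) :
    ∃ K : ℝ, 0 ≤ K ∧ ∀ x y : ℝ, 0 ≤ x → 0 ≤ y →
      y ^ p - ((max p q - 1) * x) ^ p ≤ K * ((y - (max p q - 1) * x) * (x + y) ^ (p - 1)) := by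
  have hp1 := hpq.lt
  have hp0 : 0 < p := by linarith
  have hq : q - 1 = 1 / (p - 1) := by
    have := hpq.sub_one_mul_conj
    have h1 : p - 1 ≠ 0 := by linarith
    field_simp; linarith
  have h1 : 0 < p - 1 := by linarith
  rcases le_total 2 p with h2 | h2
  · have hmax : max p q = p := by
      refine max_eq_left ?_
      have : 1 / (p - 1) ≤ 1 := by rw [div_le_one h1]; linarith
      linarith
    refine ⟨p * ((p - 1) / p) ^ (p - 1), by positivity, fun x y hx hy => ?_⟩
    rw [hmax]
    -- The roles `b = y`, `t = (p - 1) x` make the weighted mean a multiple of `x + y`; for `p ≤ 2`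
    -- the roles are exchanged.
    have := rpow_sub_rpow_ge_of_two_le h2 hy (mul_nonneg h1.le hx)
    rw [show ((p - 1) * x + (p - 1) * y) / p = ((p - 1) / p) * (x + y) by ring,
      Real.mul_rpow (x := (p - 1) / p) (by positivity) (by positivity)] at this
    linarith
  · have hmax : max p q = q := by
      refine max_eq_right ?_
      have : 1 ≤ 1 / (p - 1) := by rw [one_le_div h1]; linarith
      linarith
    refine ⟨p * (1 / p) ^ (p - 1), by positivity, fun x y hx hy => ?_⟩
    rw [hmax, hq]
    have := rpow_sub_rpow_le_of_le_two hp1 h2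
      (mul_nonneg (by positivity : 0 ≤ 1 / (p - 1)) hx) hy
    rw [show (y + (p - 1) * (1 / (p - 1) * x)) / p = (1 / p) * (x + y) by field_simp; ring,
      Real.mul_rpow (x := 1 / p) (by positivity) (by positivity)] at this
    linarith

/-- Burkholder's function majorizes `|y|^p - (p^* - 1)^p |x|^p`, up to a constant factor. -/
theorem exists_rpow_sub_rpow_le_burkholderFun {p q : ℝ} (hpq : p.HolderConjugate q) :
    ∃ K : ℝ, 0 ≤ K ∧ ∀ x y : ℝ, |y| ^ p - ((max p q - 1) * |x|) ^ p ≤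
      K * burkholderFun p (max p q) (x + y) (x - y) := by
  obtain ⟨K, hK, h⟩ := exists_rpow_sub_rpow_le hpq
  refine ⟨K / 2, by positivity, fun x y => (h |x| |y| (abs_nonneg x) (abs_nonneg y)).trans_eq ?_⟩
  unfold burkholderFun
  rw [show max |x + y| |x - y| = |x| + |y| from ?_, show x + y - (x - y) = 2 * y by ring,
    show x + y + (x - y) = 2 * x by ring, abs_mul, abs_mul, abs_two]
  · ring
  · rcases abs_cases x with hx | hx <;> rcases abs_cases y with hy | hy <;>
    rcases abs_cases (x + y) with hxy | hxy <;> rcases abs_cases (x - y) with hxy' | hxy' <;>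
    rcases max_cases |x + y| |x - y| with hm | hm <;> linarith

theorem holderConjugate_max_bounds {p q : ℝ} (hpq : p.HolderConjugate q) :
    2 ≤ max p q ∧ p ≤ max p q ∧ p + max p q ≤ p * max p q := by
  have hp1 := hpq.lt
  have h1 := hpq.mul_eq_add
  have hq : q ≤ max p q := le_max_right _ _
  have h2 : p + max p q ≤ p * max p q := by
    nlinarith [mul_nonneg (sub_nonneg.2 hp1.le) (sub_nonneg.2 hq)]
  refine ⟨?_, le_max_left _ _, h2⟩
  nlinarith [le_max_left p q]

/-! ### Burkholder's inequality -/

section Burkholder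

variable {Ω : Type*} [MeasurableSpace Ω] {μ : Measure Ω} {p : ℝ≥0∞}
  {f : ℕ → Lp ℝ p μ}

/-- The σ-algebra generated by the first `n` terms. -/
@[reducible]
noncomputable def pastSigma (f : ℕ → Lp ℝ p μ) (n : ℕ) : MeasurableSpace Ω :=
  ⨆ i, ⨆ (_ : i < n), MeasurableSpace.comap (f i : Ω → ℝ) inferInstance

theorem measurable_pastSigma {i n : ℕ} (hi : i < n) : Measurable[pastSigma f n] (f i : Ω → ℝ) := by
  refine Measurable.mono (comap_measurable _) ?_ le_rfl
  exact le_iSup₂_of_le i hi le_rfl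

theorem pastSigma_le (f : ℕ → Lp ℝ p μ) (n : ℕ) : pastSigma f n ≤ ‹MeasurableSpace Ω› :=
  iSup₂_le fun i _ => (Lp.stronglyMeasurable (f i)).measurable.comap_le

theorem IsSymmThreeValuedMDS.ae_abs_le_one (hf : IsSymmThreeValuedMDS f) (n : ℕ) :
    ∀ᵐ ω ∂μ, |f n ω| ≤ 1 := by
  filter_upwards [hf.values n] with ω hω
  rcases hω with h | h | h <;> simp [h]

theorem IsSymmThreeValuedMDS.memLp [IsFiniteMeasure μ] (hf : IsSymmThreeValuedMDS f) (n : ℕ)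
    (s : ℝ≥0∞) : MemLp (f n) s μ :=
  MemLp.of_bound (Lp.aestronglyMeasurable _) 1 (by simpa using hf.ae_abs_le_one n)

/-- The pointwise partial sums `∑_{k < n} a_k f_k`. -/
noncomputable def partialSum (f : ℕ → Lp ℝ p μ) (a : ℕ → ℝ) (n : ℕ) (ω : Ω) : ℝ :=
  ∑ k ∈ Finset.range n, a k * f k ω

theorem measurable_partialSum (a : ℕ → ℝ) (n : ℕ) :
    Measurable[pastSigma f n] (partialSum f a n) := by
  unfold partialSum
  refine Finset.measurable_fun_sum _ fun k hk => ?_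
  exact (measurable_pastSigma (Finset.mem_range.1 hk)).const_mul _

theorem IsSymmThreeValuedMDS.ae_abs_partialSum_le (hf : IsSymmThreeValuedMDS f) (a : ℕ → ℝ)
    (n : ℕ) : ∀ᵐ ω ∂μ, |partialSum f a n ω| ≤ ∑ k ∈ Finset.range n, |a k| := by
  filter_upwards [ae_all_iff.2 hf.ae_abs_le_one] with ω hω
  refine (Finset.abs_sum_le_sum_abs _ _).trans (Finset.sum_le_sum fun k _ => ?_)
  rw [abs_mul]
  exact mul_le_of_le_one_right (abs_nonneg _) (hω k)

theorem IsSymmThreeValuedMDS.exists_ae_bound (hf : IsSymmThreeValuedMDS f) (a b : ℕ → ℝ)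
    (n : ℕ) {g : ℝ × ℝ → ℝ} (hg : Continuous g) :
    ∃ B, ∀ᵐ ω ∂μ, |g (partialSum f a n ω, partialSum f b n ω)| ≤ B := by
  obtain ⟨B, hB⟩ := ((isCompact_Icc (a := -∑ k ∈ Finset.range n, |a k|)
    (b := ∑ k ∈ Finset.range n, |a k|)).prod (isCompact_Icc (a := -∑ k ∈ Finset.range n, |b k|)
    (b := ∑ k ∈ Finset.range n, |b k|))).exists_bound_of_continuousOn hg.continuousOn
  refine ⟨B, ?_⟩
  filter_upwards [hf.ae_abs_partialSum_le a n, hf.ae_abs_partialSum_le b n] with ω h1 h2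
  exact hB _ ⟨abs_le.1 h1, abs_le.1 h2⟩

theorem measurable_comp_partialSum (a b : ℕ → ℝ) (n : ℕ) {g : ℝ × ℝ → ℝ} (hg : Continuous g) :
    Measurable[pastSigma f n] fun ω => g (partialSum f a n ω, partialSum f b n ω) :=
  hg.measurable.comp ((measurable_partialSum a n).prodMk (measurable_partialSum b n))

theorem norm_sum_smul_eq [Fact (1 ≤ p)] (hp : p ≠ ∞) (f : ℕ → Lp ℝ p μ) (a : ℕ → ℝ) (n : ℕ) :
    ‖∑ k ∈ Finset.range n, a k • f k‖ =
      (∫ ω, |partialSum f a n ω| ^ p.toReal ∂μ) ^ p.toReal⁻¹ := by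
  have hp0 : p ≠ 0 := (zero_lt_one.trans_le (Fact.out : 1 ≤ p)).ne'
  have hae : (∑ k ∈ Finset.range n, a k • f k : Lp ℝ p μ) =ᵐ[μ] partialSum f a n := by
    refine (Lp.coeFn_fun_finsetSum _ _).trans ?_
    filter_upwards [ae_all_iff.2 fun k => Lp.coeFn_smul (a k) (f k)] with ω hω
    unfold partialSum
    exact Finset.sum_congr rfl fun k _ => by rw [hω k]; rfl
  rw [Lp.norm_def, toReal_eLpNorm (Lp.aestronglyMeasurable _),
    lpNorm_eq_integral_norm_rpow_toReal hp0 hp (Lp.aestronglyMeasurable _)]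
  congr 1
  refine integral_congr_ae ?_
  filter_upwards [hae] with ω hω
  rw [hω, Real.norm_eq_abs]

variable [IsProbabilityMeasure μ]

theorem IsSymmThreeValuedMDS.integral_mul_eq_zero (hf : IsSymmThreeValuedMDS f) (n : ℕ)
    {φ : Ω → ℝ} (hφ : Measurable[pastSigma f n] φ) {B : ℝ} (hB : ∀ᵐ ω ∂μ, |φ ω| ≤ B) :
    ∫ ω, φ ω * f n ω ∂μ = 0 := by
  have hfi : Integrable (f n) μ := memLp_one_iff_integrable.1 (hf.memLp n 1)
  cases n with
  | zero =>
    -- The martingale condition says nothing about the first term; its mean vanishes by symmetry,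
    -- and `φ` is constant since the past is trivial.
    have h0 : ∫ ω, f 0 ω ∂μ = 0 := by
      have := (hf.symm 0).integral_eq
      rw [integral_neg] at this
      linarith
    have hbot : pastSigma f 0 = ⊥ := by simp [pastSigma]
    rw [hbot] at hφ
    obtain ⟨c, hc⟩ := stronglyMeasurable_bot_iff.1 hφ.stronglyMeasurable
    simp [hc, integral_const_mul, h0]
  | succ n =>
    have hle := pastSigma_le f (n + 1)
    have hprod : Integrable (φ * (f (n + 1) : Ω → ℝ)) μ := by
      refine hfi.bdd_mul (c := B) (hφ.mono hle le_rfl).aestronglyMeasurable ?_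
      simpa using hB
    have hpull := condExp_mul_of_stronglyMeasurable_left
      (m := pastSigma f (n + 1)) hφ.stronglyMeasurable hprod hfi
    have hsig : pastSigma f (n + 1) =
        ⨆ i ≤ n, MeasurableSpace.comap (f i : Ω → ℝ) inferInstance := by
      simp only [pastSigma, Nat.lt_succ_iff]
    have hmds := hf.mds n
    rw [← hsig] at hmds
    rw [show (∫ ω, φ ω * f (n + 1) ω ∂μ) = ∫ ω, (φ * (f (n + 1) : Ω → ℝ)) ω ∂μ from rfl,
      ← integral_condExp hle]
    rw [integral_eq_zero_of_ae]
    filter_upwards [hpull, hmds] with ω h1 h2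
    rw [h1, Pi.mul_apply, h2]
    simp

theorem IsSymmThreeValuedMDS.integrable_comp_partialSum (hf : IsSymmThreeValuedMDS f)
    (a b : ℕ → ℝ) (n : ℕ) {g : ℝ × ℝ → ℝ} (hg : Continuous g) :
    Integrable (fun ω => g (partialSum f a n ω, partialSum f b n ω)) μ := by
  obtain ⟨B, hB⟩ := hf.exists_ae_bound a b n hg
  exact Integrable.of_bound ((measurable_comp_partialSum a b n hg).mono (pastSigma_le f n)
    le_rfl).aestronglyMeasurable B hB

theorem IsSymmThreeValuedMDS.integral_burkholderFun_nonpos (hf : IsSymmThreeValuedMDS f)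
    {t r : ℝ} (ht : 1 < t) (hr : 2 ≤ r) (htr : t ≤ r) (htr' : t + r ≤ t * r)
    (a e : ℕ → ℝ) (he : ∀ k, e k = 1 ∨ e k = -1) (n : ℕ) :
    ∫ ω, burkholderFun t r (partialSum f a n ω + partialSum f (fun k => e k * a k) n ω)
      (partialSum f a n ω - partialSum f (fun k => e k * a k) n ω) ∂μ ≤ 0 := by
  set b : ℕ → ℝ := fun k => e k * a k with hb
  have hcont : ∀ h k : ℝ, Continuous fun z : ℝ × ℝ =>
      burkholderFun t r ((z.1 + h) + (z.2 + k)) ((z.1 + h) - (z.2 + k)) := fun h k =>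
    (continuous_burkholderFun ht).comp (by fun_prop : Continuous fun z : ℝ × ℝ =>
      ((z.1 + h) + (z.2 + k), (z.1 + h) - (z.2 + k)))
  have hcont0 : Continuous fun z : ℝ × ℝ => burkholderFun t r (z.1 + z.2) (z.1 - z.2) := by
    simpa using hcont 0 0
  induction n with
  | zero =>
    have : (0 : ℝ) ^ (t - 1) = 0 := Real.zero_rpow (by linarith)
    simp [partialSum, burkholderFun]
  | succ n ih =>
    refine le_trans ?_ ih
    -- Half the difference of the values after a step up and a step down: the slope of the chord. By
    -- zigzag concavity the new value is at most the old one plus `φ * f n`, with equality when `f n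
    -- = 0`, and `φ * f n` has integral zero.
    set φ : ℝ × ℝ → ℝ := fun z =>
      (burkholderFun t r ((z.1 + a n) + (z.2 + b n)) ((z.1 + a n) - (z.2 + b n)) -
       burkholderFun t r ((z.1 + -a n) + (z.2 + -b n)) ((z.1 + -a n) - (z.2 + -b n))) / 2 with hφ
    have hφc : Continuous φ := ((hcont _ _).sub (hcont _ _)).div_const 2
    obtain ⟨B, hB⟩ := hf.exists_ae_bound a b n hφc
    have hzero := hf.integral_mul_eq_zero n (measurable_comp_partialSum a b n hφc) hB
    have hi1 := hf.integrable_comp_partialSum a b n hcont0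
    have hi2 : Integrable
        (fun ω => φ (partialSum f a n ω, partialSum f b n ω) * f n ω) μ := by
      refine (memLp_one_iff_integrable.1 (hf.memLp n 1)).bdd_mul (c := B)
        ((measurable_comp_partialSum a b n hφc).mono (pastSigma_le f n)
        le_rfl).aestronglyMeasurable ?_
      simpa using hB
    refine le_trans (integral_mono_ae (hf.integrable_comp_partialSum a b (n + 1) hcont0)
      (hi1.add hi2) ?_) (((integral_add hi1 hi2).trans (by rw [hzero, add_zero])).le)
    filter_upwards [hf.values n] with ω hω
    have hzz := burkholderFun_zigzag ht hr htr htr' (partialSum f a n ω) (partialSum f b n ω)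
      (a n) (he n)
    have hsa : partialSum f a (n + 1) ω = partialSum f a n ω + a n * f n ω :=
      Finset.sum_range_succ _ _
    have hsb : partialSum f b (n + 1) ω = partialSum f b n ω + b n * f n ω :=
      Finset.sum_range_succ _ _
    rw [show e n * a n = b n from rfl] at hzz
    simp only [hsa, hsb, hφ, Pi.add_apply]
    rcases hω with h | h | h <;> rw [h] <;>
      simp only [mul_neg, mul_one, mul_zero, add_zero, ← sub_eq_add_neg, le_refl] <;> linarith

theorem IsSymmThreeValuedMDS.integral_rpow_partialSum_le (hf : IsSymmThreeValuedMDS f)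
    {t s : ℝ} (hts : t.HolderConjugate s)
    (a e : ℕ → ℝ) (he : ∀ k, e k = 1 ∨ e k = -1) (n : ℕ) :
    ∫ ω, |partialSum f (fun k => e k * a k) n ω| ^ t ∂μ ≤
      (max t s - 1) ^ t * ∫ ω, |partialSum f a n ω| ^ t ∂μ := by
  obtain ⟨K, hK, h⟩ := exists_rpow_sub_rpow_le_burkholderFun hts
  obtain ⟨h1, h2, h3⟩ := holderConjugate_max_bounds hts
  have ht := hts.lt
  have hneg := hf.integral_burkholderFun_nonpos ht h1 h2 h3 a e he n
  set b : ℕ → ℝ := fun k => e k * a k with hb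
  set r := max t s
  have c1 : Continuous fun z : ℝ × ℝ => burkholderFun t r (z.1 + z.2) (z.1 - z.2) :=
    (continuous_burkholderFun ht).comp (by fun_prop : Continuous fun z : ℝ × ℝ =>
      (z.1 + z.2, z.1 - z.2))
  have c2 : Continuous fun z : ℝ × ℝ => |z.1| ^ t :=
    Continuous.rpow_const (by fun_prop) fun _ => Or.inr (by linarith)
  have c3 : Continuous fun z : ℝ × ℝ => |z.2| ^ t :=
    Continuous.rpow_const (by fun_prop) fun _ => Or.inr (by linarith)
  have i1 := hf.integrable_comp_partialSum a b n c1
  have i2 := hf.integrable_comp_partialSum a b n c2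
  have i3 := hf.integrable_comp_partialSum a b n c3
  have hint : ∫ ω, (|partialSum f b n ω| ^ t - (r - 1) ^ t * |partialSum f a n ω| ^ t) ∂μ ≤
      ∫ ω, K * burkholderFun t r (partialSum f a n ω + partialSum f b n ω)
        (partialSum f a n ω - partialSum f b n ω) ∂μ := by
    refine integral_mono (i3.sub (i2.const_mul _)) (i1.const_mul K) fun ω => ?_
    have := h (partialSum f a n ω) (partialSum f b n ω)
    rwa [Real.mul_rpow (by linarith) (abs_nonneg _)] at this
  rw [integral_sub i3 (i2.const_mul _), integral_const_mul, integral_const_mul] at hint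
  have := mul_nonpos_of_nonneg_of_nonpos hK hneg
  linarith

variable [Fact (1 ≤ p)]

/-- **Burkholder's inequality** for sign multipliers. -/
theorem IsSymmThreeValuedMDS.norm_sum_sign_le (hf : IsSymmThreeValuedMDS f) {q : ℝ≥0∞}
    (hp : p ≠ ∞) (hpq : p.toReal.HolderConjugate q.toReal)
    (a e : ℕ → ℝ) (he : ∀ k, e k = 1 ∨ e k = -1) (n : ℕ) :
    ‖∑ k ∈ Finset.range n, (e k * a k) • f k‖ ≤
      (max p.toReal q.toReal - 1) * ‖∑ k ∈ Finset.range n, a k • f k‖ := by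
  have h := hf.integral_rpow_partialSum_le hpq a e he n
  have hr := (holderConjugate_max_bounds hpq).1
  have hp0 : 0 < p.toReal := hpq.pos
  have hnn : 0 ≤ ∫ ω, |partialSum f a n ω| ^ p.toReal ∂μ := integral_nonneg fun _ => by positivity
  rw [norm_sum_smul_eq hp f (fun k => e k * a k), norm_sum_smul_eq hp f]
  refine (Real.rpow_le_rpow (integral_nonneg fun _ => by positivity) h (by positivity)).trans_eq ?_
  rw [Real.mul_rpow (Real.rpow_nonneg (by linarith) _) hnn, Real.rpow_rpow_inv (by linarith) hp0.ne']

/-- **Burkholder's inequality** for multipliers bounded by `1`. -/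
theorem IsSymmThreeValuedMDS.norm_sum_mul_le (hf : IsSymmThreeValuedMDS f) {q : ℝ≥0∞}
    (hp : p ≠ ∞) (hpq : p.toReal.HolderConjugate q.toReal)
    (a v : ℕ → ℝ) (hv : ∀ k, |v k| ≤ 1) (n : ℕ) :
    ‖∑ k ∈ Finset.range n, (v k * a k) • f k‖ ≤
      (max p.toReal q.toReal - 1) * ‖∑ k ∈ Finset.range n, a k • f k‖ := by
  let L : (Fin n → ℝ) →ₗ[ℝ] Lp ℝ p μ :=
    { toFun := fun v => ∑ k, (v k * a k) • f k
      map_add' := fun x y => by simp [add_mul, add_smul, Finset.sum_add_distrib]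
      map_smul' := fun c x => by simp [Finset.smul_sum, mul_smul, mul_assoc] }
  have hconv : ConvexOn ℝ Set.univ fun v => ‖L v‖ := convexOn_univ_norm.comp_linearMap L
  -- The cube is the convex hull of the sign vectors, so the convex function `‖L v‖` is dominated by
  -- its value at some sign vector.
  have hmem : (fun k : Fin n => v k) ∈ convexHull ℝ
      (Set.pi Set.univ fun _ : Fin n => ({-1, 1} : Set ℝ)) := by
    refine mem_convexHull_pi fun k _ => ?_
    rw [convexHull_pair, segment_eq_Icc (by norm_num)]
    exact abs_le.1 (hv k)
  obtain ⟨w, hw, hle⟩ := hconv.exists_ge_of_mem_convexHull (Set.subset_univ _) hmem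
  have h1 := hf.norm_sum_sign_le hp hpq a (fun k => if h : k < n then w ⟨k, h⟩ else 1) (fun k => by
    by_cases hk : k < n
    · have := hw ⟨k, hk⟩ (Set.mem_univ _)
      simp only [Set.mem_insert_iff, Set.mem_singleton_iff] at this
      simpa [hk] using this.symm
    · simp [hk]) n
  rw [Finset.sum_range] at h1 ⊢
  simp only [Fin.is_lt, dite_true] at h1
  exact hle.trans h1

end Burkholder

/-! ### The integral pairing -/

section Pairing

variable {Ω : Type*} [MeasurableSpace Ω] {μ : Measure Ω} {p q : ℝ≥0∞}

theorem abs_pairing_le [hpq : p.HolderConjugate q] {g h : Ω → ℝ} (hg : MemLp g q μ)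
    (hh : MemLp h p μ) :
    |pairing μ g h| ≤ (eLpNorm g q μ).toReal * (eLpNorm h p μ).toReal := by
  have : q.HolderConjugate p := hpq.symm
  have h1 : eLpNorm (g • h) 1 μ ≤ eLpNorm g q μ * eLpNorm h p μ :=
    eLpNorm_smul_le_mul_eLpNorm hh.1 hg.1
  have htop : eLpNorm g q μ * eLpNorm h p μ ≠ ∞ :=
    ENNReal.mul_ne_top hg.eLpNorm_ne_top hh.eLpNorm_ne_top
  rw [← ENNReal.toReal_mul]
  refine le_trans ?_ (ENNReal.toReal_mono htop h1)
  have h2 := norm_integral_le_lintegral_norm (μ := μ) (g • h)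
  rw [eLpNorm_one_eq_lintegral_enorm]
  simp_rw [ofReal_norm] at h2
  exact h2

theorem integrable_mul_of_holderConjugate [hpq : p.HolderConjugate q] {g h : Ω → ℝ}
    (hg : MemLp g q μ) (hh : MemLp h p μ) : Integrable (fun ω => g ω * h ω) μ := by
  have : q.HolderConjugate p := hpq.symm
  exact hg.integrable_mul hh

theorem pairing_comm (g h : Ω → ℝ) : pairing μ g h = pairing μ h g := by
  simp [pairing, mul_comm]

theorem pairing_congr {g g' h h' : Ω → ℝ} (hg : g =ᵐ[μ] g') (hh : h =ᵐ[μ] h') :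
    pairing μ g h = pairing μ g' h' := by
  refine integral_congr_ae ?_
  filter_upwards [hg, hh] with ω h1 h2
  rw [h1, h2]

/-- The bounded functional `h ↦ ⟨g, h⟩` on `L_p` given by `g ∈ L_q`. -/
noncomputable def pairingCLM [Fact (1 ≤ p)] [p.HolderConjugate q] (g : Ω → ℝ) (hg : MemLp g q μ) :
    Lp ℝ p μ →L[ℝ] ℝ :=
  LinearMap.mkContinuous
    { toFun := fun h => pairing μ g h
      map_add' := fun x y => by
        rw [pairing_congr (Filter.EventuallyEq.refl _ g) (Lp.coeFn_add x y)]
        simp only [pairing, Pi.add_apply, mul_add]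
        exact integral_add (integrable_mul_of_holderConjugate hg (Lp.memLp x))
          (integrable_mul_of_holderConjugate hg (Lp.memLp y))
      map_smul' := fun c x => by
        rw [pairing_congr (Filter.EventuallyEq.refl _ g) (Lp.coeFn_smul c x)]
        simp only [pairing, Pi.smul_apply, smul_eq_mul, RingHom.id_apply, ← integral_const_mul]
        exact integral_congr_ae (Filter.Eventually.of_forall fun ω => by ring) }
    (eLpNorm g q μ).toReal (fun x => abs_pairing_le hg (Lp.memLp x))

@[simp]
theorem pairingCLM_apply [Fact (1 ≤ p)] [p.HolderConjugate q] (g : Ω → ℝ) (hg : MemLp g q μ)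
    (h : Lp ℝ p μ) : pairingCLM g hg h = pairing μ g h := rfl

end Pairing

/-! ### Multiplier operators and the Schauder basis -/

section ClosedSpan

variable {Ω : Type*} [MeasurableSpace Ω] {μ : Measure Ω} {p : ℝ≥0∞} [Fact (1 ≤ p)]
  {f : ℕ → Lp ℝ p μ}

instance completeSpace_closedSpan (f : ℕ → Lp ℝ p μ) : CompleteSpace (closedSpan f) :=
  (Submodule.isClosed_topologicalClosure _).completeSpace_coe

theorem norm_sum_smul_gen (a : ℕ → ℝ) (s : Finset ℕ) :
    ‖∑ k ∈ s, a k • gen f k‖ = ‖∑ k ∈ s, a k • f k‖ := by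
  change ‖((∑ k ∈ s, a k • gen f k : closedSpan f) : Lp ℝ p μ)‖ = _
  congr 1
  simp [gen]

theorem denseRange_linearCombination_gen (f : ℕ → Lp ℝ p μ) :
    DenseRange (Finsupp.linearCombination ℝ (gen f)) := by
  intro x
  rw [closure_subtype]
  refine closure_mono ?_ (show (x : Lp ℝ p μ) ∈ closure (Submodule.span ℝ (Set.range f) : Set _)
    from x.2)
  intro y hy
  obtain ⟨c, rfl⟩ := (Finsupp.mem_span_range_iff_exists_finsupp).1 hy
  refine ⟨_, ⟨c, rfl⟩, ?_⟩
  simp [Finsupp.linearCombination_apply, Finsupp.sum, gen]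

/-- Burkholder's inequality is available for initial segments; this puts finitely supported
combinations in that form, with a common length for different `v`. -/
theorem linearCombination_gen_eq_sum_range (c : ℕ →₀ ℝ) (v : ℕ → ℝ) :
    ∃ N, ∀ n, N ≤ n → Finsupp.linearCombination ℝ (fun k => v k • gen f k) c =
      ∑ k ∈ Finset.range n, (v k * c k) • gen f k := by
  refine ⟨c.support.sup id + 1, fun n hn => ?_⟩
  rw [Finsupp.linearCombination_apply, Finsupp.sum]
  simp only [smul_smul, mul_comm (v _)]
  refine Finset.sum_subset (fun k hk => ?_) (fun k _ hk => ?_)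
  · have : id k ≤ c.support.sup id := Finset.le_sup hk
    simp only [id] at this
    exact Finset.mem_range.2 (by omega)
  · rw [Finsupp.notMem_support_iff.1 hk, zero_mul, zero_smul]

end ClosedSpan

section Basis

variable {Ω : Type*} [MeasurableSpace Ω] {μ : Measure Ω} [IsProbabilityMeasure μ] {p q : ℝ≥0∞}
  {f : ℕ → Lp ℝ p μ}

theorem IsSymmThreeValuedMDS.pairing_eq_zero (hf : IsSymmThreeValuedMDS f) {m n : ℕ}
    (hmn : m ≠ n) : pairing μ (f m) (f n) = 0 := by
  rcases lt_or_gt_of_ne hmn with h | h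
  · exact hf.integral_mul_eq_zero n (measurable_pastSigma h) (hf.ae_abs_le_one m)
  · rw [pairing_comm]
    exact hf.integral_mul_eq_zero m (measurable_pastSigma h) (hf.ae_abs_le_one n)

theorem IsSymmThreeValuedMDS.pairing_self_ne_zero (hf : IsSymmThreeValuedMDS f) (n : ℕ) :
    pairing μ (f n) (f n) ≠ 0 := by
  intro h
  refine hf.ne_zero n ((Lp.eq_zero_iff_ae_eq_zero).2 ?_)
  have hint : Integrable (fun ω => f n ω * f n ω) μ := (hf.memLp n 2).integrable_mul (hf.memLp n 2)
  have := (integral_eq_zero_iff_of_nonneg (fun ω => mul_self_nonneg (f n ω)) hint).1 h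
  filter_upwards [this] with ω hω
  simpa using hω

variable [Fact (1 ≤ p)]

/-- The coordinate functionals as bounded functionals. -/
noncomputable def coordCLM [p.HolderConjugate q] (hf : IsSymmThreeValuedMDS f) (n : ℕ) :
    closedSpan f →L[ℝ] ℝ :=
  (pairing μ (f n) (f n))⁻¹ • (pairingCLM (f n) (hf.memLp n q)).comp (closedSpan f).subtypeL

theorem coordCLM_apply [p.HolderConjugate q] (hf : IsSymmThreeValuedMDS f) (n : ℕ)
    (x : closedSpan f) : coordCLM (q := q) hf n x = coordFn f n x := rfl

theorem IsSymmThreeValuedMDS.coordFn_gen (hf : IsSymmThreeValuedMDS f) (m n : ℕ) :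
    coordFn f m (gen f n) = if m = n then 1 else 0 := by
  unfold coordFn gen
  split_ifs with h
  · subst h
    exact inv_mul_cancel₀ (hf.pairing_self_ne_zero m)
  · rw [hf.pairing_eq_zero h, mul_zero]

/-- Multipliers bounded by `K` act boundedly on the closed span. -/
theorem IsSymmThreeValuedMDS.exists_multiplier (hf : IsSymmThreeValuedMDS f) (hp : p ≠ ∞)
    (hpq : p.toReal.HolderConjugate q.toReal) {K : ℝ} (hK : 0 < K) (v : ℕ → ℝ)
    (hv : ∀ k, |v k| ≤ K) :
    ∃ D : closedSpan f →L[ℝ] closedSpan f, (∀ n, D (gen f n) = v n • gen f n) ∧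
      ‖D‖ ≤ (max p.toReal q.toReal - 1) * K := by
  have hr := (holderConjugate_max_bounds hpq).1
  set r := max p.toReal q.toReal
  have hnorm : ∀ c : ℕ →₀ ℝ, ‖Finsupp.linearCombination ℝ (fun k => v k • gen f k) c‖ ≤
      (r - 1) * K * ‖Finsupp.linearCombination ℝ (gen f) c‖ := by
    intro c
    obtain ⟨N, hN⟩ := linearCombination_gen_eq_sum_range (f := f) c v
    obtain ⟨M, hM⟩ := linearCombination_gen_eq_sum_range (f := f) c 1
    have h1 := hN (max N M) (le_max_left _ _)
    have h2 := hM (max N M) (le_max_right _ _)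
    simp only [Pi.one_apply, one_smul, one_mul] at h2
    rw [h1, show gen f = fun k => gen f k from rfl, h2, norm_sum_smul_gen, norm_sum_smul_gen]
    have h3 := hf.norm_sum_mul_le hp hpq (fun k => K * c k) (fun k => K⁻¹ * v k) (fun k => by
      rw [abs_mul, abs_inv, abs_of_pos hK, inv_mul_le_iff₀ hK, mul_one]; exact hv k) (max N M)
    have h4 : ∀ k, K⁻¹ * v k * (K * c k) = v k * c k := fun k => by field_simp
    simp only [h4, mul_smul K, ← Finset.smul_sum] at h3
    rw [norm_smul, Real.norm_eq_abs, abs_of_pos hK, ← mul_assoc] at h3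
    exact h3
  refine ⟨(Finsupp.linearCombination ℝ (fun k => v k • gen f k)).extendOfNorm
    (Finsupp.linearCombination ℝ (gen f)), fun n => ?_, ?_⟩
  · have := LinearMap.extendOfNorm_eq (denseRange_linearCombination_gen f) ⟨_, hnorm⟩
      (Finsupp.single n 1)
    simpa using this
  · exact LinearMap.opNorm_extendOfNorm_le (denseRange_linearCombination_gen f)
      (mul_nonneg (by linarith) hK.le) hnorm

/-- The expansions `∑ f_k^*(x) f_k` converge to `x`. -/
theorem IsSymmThreeValuedMDS.tendsto_sum_coordFn (hf : IsSymmThreeValuedMDS f) (hp : p ≠ ∞)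
    [p.HolderConjugate q] (hpq : p.toReal.HolderConjugate q.toReal) (x : closedSpan f) :
    Filter.Tendsto (fun n => ∑ k ∈ Finset.range n, coordFn f k x • gen f k) Filter.atTop
      (nhds x) := by
  have hr := (holderConjugate_max_bounds hpq).1
  set r := max p.toReal q.toReal
  let P : ℕ → closedSpan f →L[ℝ] closedSpan f := fun n =>
    ∑ k ∈ Finset.range n, (coordCLM (q := q) hf k).smulRight (gen f k)
  have hP : ∀ n x, P n x = ∑ k ∈ Finset.range n, coordFn f k x • gen f k := fun n x => by
    simp [P, coordCLM_apply]
  have hPgen : ∀ n k, P n (gen f k) = (if k < n then (1 : ℝ) else 0) • gen f k := fun n k => by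
    simp [hP, hf.coordFn_gen]
  -- Each partial-sum projection is a 0/1 multiplier. The uniform bound reduces convergence to the
  -- dense span, where the partial sums are eventually exact.
  have hPbound : ∀ n, ‖P n‖ ≤ r - 1 := by
    intro n
    obtain ⟨D, hD, hDn⟩ := hf.exists_multiplier hp hpq one_pos (fun k => if k < n then (1 : ℝ) else 0)
      (fun k => by split_ifs <;> simp)
    have : P n = D := by
      refine DFunLike.coe_injective
        ((denseRange_linearCombination_gen f).equalizer (P n).continuous D.continuous ?_)
      funext c
      simp only [Function.comp_apply, Finsupp.linearCombination_apply, Finsupp.sum, map_sum,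
        map_smul, hPgen, hD]
    rw [this, ← mul_one (r - 1)]
    exact hDn
  simp only [← hP]
  rw [Metric.tendsto_atTop]
  intro ε hε
  obtain ⟨c, hc⟩ := (denseRange_linearCombination_gen f).exists_dist_lt x
    (div_pos hε (by linarith : 0 < r))
  obtain ⟨N, hN⟩ := linearCombination_gen_eq_sum_range (f := f) c 1
  simp only [Pi.one_apply, one_smul, one_mul] at hN
  change ∀ n, N ≤ n → Finsupp.linearCombination ℝ (gen f) c = _ at hN
  set y := Finsupp.linearCombination ℝ (gen f) c
  refine ⟨N, fun n hn => ?_⟩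
  have hPy : P n y = y := by
    rw [hN n hn, map_sum]
    refine Finset.sum_congr rfl fun k hk => ?_
    rw [map_smul, hPgen, if_pos (Finset.mem_range.1 hk), one_smul]
  rw [dist_eq_norm, show P n x - x = P n (x - y) - (x - y) by rw [map_sub, hPy]; abel]
  rw [dist_eq_norm] at hc
  calc ‖P n (x - y) - (x - y)‖ ≤ ‖P n (x - y)‖ + ‖x - y‖ := norm_sub_le _ _
    _ ≤ (r - 1) * ‖x - y‖ + ‖x - y‖ := by gcongr; exact (P n).le_of_opNorm_le (hPbound n) _
    _ = r * ‖x - y‖ := by ring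
    _ < r * (ε / r) := by gcongr
    _ = ε := by field_simp

/-- The sequence as a Schauder basis of its closed span. -/
noncomputable def mdsBasis (hf : IsSymmThreeValuedMDS f) (hp : p ≠ ∞)
    [p.HolderConjugate q] (hpq : p.toReal.HolderConjugate q.toReal) :
    SchauderBasis ℝ (closedSpan f) where
  basis := gen f
  coord := coordCLM (q := q) hf
  ortho i j := by
    rw [coordCLM_apply, hf.coordFn_gen]
    convert (Pi.single_apply j (1 : ℝ) i).symm
    rfl
  expansion x := by
    rw [HasSum, SummationFilter.conditional_filter_eq_map_range, Filter.tendsto_map'_iff]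
    exact hf.tendsto_sum_coordFn hp hpq x

end Basis

/-! ### Norm bound for the formal adjoint -/

section Duality

variable {Ω : Type*} [MeasurableSpace Ω] {μ : Measure Ω} {p q : ℝ≥0∞}

/-- The `L_q` norm of a bounded truncation `g` of `F` is determined by testing `F` against bounded
measurable functions in `L_p`. -/
theorem eLpNorm_le_of_forall_integral_mul_le_of_bounded [IsFiniteMeasure μ] (hp : p ≠ ∞) (hq : q ≠ ∞)
    (hpq : p.toReal.HolderConjugate q.toReal) {F g : Ω → ℝ} (hg : Measurable g)
    {N : ℝ} (hN : ∀ ω, |g ω| ≤ N) (hFg : ∀ ω, g ω = F ω ∨ g ω = 0) {K : ℝ} (hK : 0 ≤ K)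
    (h : ∀ φ : Ω → ℝ, Measurable φ → (∃ B, ∀ ω, |φ ω| ≤ B) →
      |∫ ω, F ω * φ ω ∂μ| ≤ K * (eLpNorm φ p μ).toReal) :
    eLpNorm g q μ ≤ ENNReal.ofReal K := by
  have hp0 : 0 < p.toReal := hpq.pos
  have hq0 : 0 < q.toReal := hpq.symm.pos
  have hp0' : p ≠ 0 := fun h => by simp [h] at hp0
  have hq0' : q ≠ 0 := fun h => by simp [h] at hq0
  set s := q.toReal with hs
  have hs1 : 1 < s := hpq.symm.lt
  -- The extremal function in Hölder's inequality: `F φ = |φ| ^ p = |g| ^ q`. The hypothesis becomes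
  -- `I ≤ K I ^ (1 / p)`, where `I` is finite because `g` is bounded.
  set φ : Ω → ℝ := fun ω => g ω * |g ω| ^ (s - 2) with hφ
  have habs : ∀ ω, |φ ω| = |g ω| ^ (s - 1) := by
    intro ω
    simp only [hφ, abs_mul, abs_of_nonneg (Real.rpow_nonneg (abs_nonneg (g ω)) _)]
    rcases eq_or_ne (g ω) 0 with h0 | h0
    · rw [h0, abs_zero, zero_mul, Real.zero_rpow (by linarith)]
    · rw [mul_comm, ← Real.rpow_add_one (abs_ne_zero.2 h0)]
      congr 1; ring
  have hφm : Measurable φ := by fun_prop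
  have hφb : ∀ ω, |φ ω| ≤ N ^ (s - 1) := fun ω => by
    rw [habs]; exact Real.rpow_le_rpow (abs_nonneg _) (hN ω) (by linarith)
  have hFφ : ∀ ω, F ω * φ ω = |g ω| ^ s := by
    intro ω
    rcases eq_or_ne (g ω) 0 with h0 | h0
    · simp [hφ, h0, Real.zero_rpow hq0.ne']
    · have hF : F ω = g ω := by
        rcases hFg ω with h1 | h1
        · exact h1.symm
        · exact absurd h1 h0
      simp only [hφ, hF]
      rw [← mul_assoc, ← abs_mul_abs_self, mul_comm, ← mul_assoc,
        ← Real.rpow_add_one (abs_ne_zero.2 h0), ← Real.rpow_add_one (abs_ne_zero.2 h0)]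
      congr 1; ring
  have hφp : ∀ ω, |φ ω| ^ p.toReal = |g ω| ^ s := fun ω => by
    rw [habs, ← Real.rpow_mul (abs_nonneg _), hpq.symm.sub_one_mul_conj]
  have hmem : MemLp g q μ :=
    MemLp.of_bound hg.aestronglyMeasurable N (Filter.Eventually.of_forall hN)
  set I := ∫ ω, |g ω| ^ s ∂μ with hI
  have hI0 : 0 ≤ I := integral_nonneg fun ω => by positivity
  have hkey := h φ hφm ⟨_, hφb⟩
  rw [toReal_eLpNorm hφm.aestronglyMeasurable,
    lpNorm_eq_integral_norm_rpow_toReal hp0' hp hφm.aestronglyMeasurable] at hkey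
  simp only [hFφ, Real.norm_eq_abs, hφp] at hkey
  rw [abs_of_nonneg hI0] at hkey
  rw [← ofReal_lpNorm hmem]
  refine ENNReal.ofReal_le_ofReal ?_
  rw [lpNorm_eq_integral_norm_rpow_toReal hq0' hq hg.aestronglyMeasurable]
  simp only [Real.norm_eq_abs]
  change I ^ s⁻¹ ≤ K
  rcases hI0.eq_or_lt with h0 | h0
  · rw [← h0, Real.zero_rpow (by positivity)]
    exact hK
  · have h1 : I = I ^ s⁻¹ * I ^ p.toReal⁻¹ := by
      rw [← Real.rpow_add h0, hpq.symm.inv_add_inv_eq_one, Real.rpow_one]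
    have h2 : 0 < I ^ p.toReal⁻¹ := by positivity
    refine le_of_mul_le_mul_right ?_ h2
    rw [← h1]
    exact hkey

/-- Bounded measurable functions norm `L_q` against `L_p`. -/
theorem eLpNorm_le_of_forall_integral_mul_le [IsFiniteMeasure μ] (hp : p ≠ ∞) (hq : q ≠ ∞)
    (hpq : p.toReal.HolderConjugate q.toReal) {F : Ω → ℝ} (hF : Measurable F) {K : ℝ} (hK : 0 ≤ K)
    (h : ∀ φ : Ω → ℝ, Measurable φ → (∃ B, ∀ ω, |φ ω| ≤ B) →
      |∫ ω, F ω * φ ω ∂μ| ≤ K * (eLpNorm φ p μ).toReal) :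
    eLpNorm F q μ ≤ ENNReal.ofReal K := by
  -- `F` is not known to lie in `L_q`, so it is cut off to bounded functions; Fatou's lemma removes
  -- the cutoff.
  let g : ℕ → Ω → ℝ := fun N => {ω | |F ω| ≤ N}.indicator F
  have hset : ∀ N : ℕ, MeasurableSet {ω | |F ω| ≤ N} := fun N =>
    measurableSet_le (by fun_prop) measurable_const
  have hg : ∀ N, Measurable (g N) := fun N => hF.indicator (hset N)
  have hlim : ∀ ω, Filter.Tendsto (fun N => g N ω) Filter.atTop (nhds (F ω)) := by
    intro ω
    obtain ⟨M, hM⟩ := exists_nat_ge |F ω|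
    refine tendsto_const_nhds.congr' ?_
    filter_upwards [Filter.eventually_ge_atTop M] with N hN
    have : ω ∈ {ω | |F ω| ≤ N} := hM.trans (Nat.cast_le.2 hN)
    exact (Set.indicator_of_mem this F).symm
  refine (Lp.eLpNorm_lim_le_liminf_eLpNorm (fun N => (hg N).aestronglyMeasurable) F
    (Filter.Eventually.of_forall hlim)).trans ?_
  have hb : ∀ N, eLpNorm (g N) q μ ≤ ENNReal.ofReal K := fun N =>
    eLpNorm_le_of_forall_integral_mul_le_of_bounded hp hq hpq (hg N) (N := N)
      (fun ω => by
        by_cases hω : |F ω| ≤ N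
        · simp [g, hω]
        · simp [g, hω])
      (fun ω => (Set.indicator_eq_zero_or_self _ F ω).symm) hK h
  exact Filter.liminf_le_of_le (by isBoundedDefault) fun b hb' => by
    obtain ⟨N, hN⟩ := hb'.exists
    exact hN.trans (hb N)

end Duality

section Adjoint

variable {Ω : Type*} [MeasurableSpace Ω] {μ : Measure Ω} {p q : ℝ≥0∞}

theorem real_inner_Lp_two_eq_pairing (u v : Lp ℝ 2 μ) : inner ℝ u v = pairing μ u v := by
  rw [L2.inner_def, pairing]
  exact integral_congr_ae (Filter.Eventually.of_forall fun ω => by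
    simp [mul_comm])

/-- On the range of an orthogonal projection `P`, pairing with `u` is pairing with `P u`. -/
theorem pairing_proj_eq [Fact (1 ≤ p)] [p.HolderConjugate q] {X : Submodule ℝ (Lp ℝ p μ)}
    {P : Lp ℝ 2 μ →L[ℝ] Lp ℝ 2 μ} (hP : IsStarProjection P)
    (hX : (X : Set (Lp ℝ p μ)) =
      closure {g : Lp ℝ p μ | ∃ f : Lp ℝ 2 μ, MemLp f p μ ∧ g =ᵐ[μ] P f})
    {u : Lp ℝ 2 μ} (hu : MemLp u q μ) (hPu : MemLp (P u) q μ) {x : Lp ℝ p μ} (hx : x ∈ X) :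
    pairing μ u x = pairing μ (P u) x := by
  have hcl : IsClosed {x : Lp ℝ p μ | pairingCLM (p := p) u hu x = pairingCLM (P u) hPu x} :=
    isClosed_eq (pairingCLM u hu).continuous (pairingCLM (P u) hPu).continuous
  have hsub : {g : Lp ℝ p μ | ∃ f : Lp ℝ 2 μ, MemLp f p μ ∧ g =ᵐ[μ] P f} ⊆
      {x : Lp ℝ p μ | pairingCLM (p := p) u hu x = pairingCLM (P u) hPu x} := by
    rintro g ⟨w, -, hg⟩
    have hsymm := ContinuousLinearMap.isSelfAdjoint_iff_isSymmetric.1 hP.isSelfAdjoint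
    have hidem : P (P w) = P w := DFunLike.congr_fun hP.isIdempotentElem w
    simp only [Set.mem_ofPred_eq, pairingCLM_apply]
    rw [pairing_congr (Filter.EventuallyEq.refl _ _) hg,
      pairing_congr (Filter.EventuallyEq.refl _ (P u : Ω → ℝ)) hg,
      ← real_inner_Lp_two_eq_pairing, ← real_inner_Lp_two_eq_pairing,
      show inner ℝ (P u) (P w) = inner ℝ u (P (P w)) from hsymm u (P w), hidem]
  have hmem : x ∈ closure {g : Lp ℝ p μ | ∃ f : Lp ℝ 2 μ, MemLp f p μ ∧ g =ᵐ[μ] P f} := by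
    rw [← hX]; exact hx
  exact closure_minimal hsub hcl hmem

theorem IsDistEmbedding.norm_eq [Fact (1 ≤ p)] {X : Submodule ℝ (Lp ℝ p μ)} {J : X →L[ℝ] Lp ℝ p μ}
    (hJ : IsDistEmbedding J) (x : X) : ‖J x‖ = ‖x‖ := by
  change ‖J x‖ = ‖(x : Lp ℝ p μ)‖
  rw [Lp.norm_def, Lp.norm_def, (hJ x).eLpNorm_eq]

variable [IsProbabilityMeasure μ]

theorem MeasureTheory.memLp_of_measurable_of_bounded {φ : Ω → ℝ} (hφ : Measurable φ)
    (hb : ∃ B, ∀ ω, |φ ω| ≤ B) (s : ℝ≥0∞) : MemLp φ s μ := by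
  obtain ⟨B, hB⟩ := hb
  exact MemLp.of_bound hφ.aestronglyMeasurable B (Filter.Eventually.of_forall hB)

/-- A `p`-`C`-bounded orthogonal projection is `q`-`C`-bounded on bounded functions. -/
theorem IsPBoundedOrthProjection.eLpNorm_conj_le [p.HolderConjugate q] (hp : p ≠ ∞) (hq : q ≠ ∞)
    (hpq : p.toReal.HolderConjugate q.toReal) {C : ℝ} (hC : 0 ≤ C)
    {P : Lp ℝ 2 μ →L[ℝ] Lp ℝ 2 μ} (hP : IsPBoundedOrthProjection p C P) {u : Lp ℝ 2 μ}
    (hu : MemLp u q μ) :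
    eLpNorm (P u) q μ ≤ ENNReal.ofReal C * eLpNorm u q μ := by
  rw [← ENNReal.ofReal_toReal hu.eLpNorm_ne_top, ← ENNReal.ofReal_mul hC]
  refine eLpNorm_le_of_forall_integral_mul_le hp hq hpq
    (Lp.stronglyMeasurable _).measurable (by positivity) fun φ hφ hb => ?_
  have hφ2 := memLp_of_measurable_of_bounded (μ := μ) hφ hb 2
  have hφp := memLp_of_measurable_of_bounded (μ := μ) hφ hb p
  set w : Lp ℝ 2 μ := hφ2.toLp φ with hw
  have hwφ : w =ᵐ[μ] φ := hφ2.coeFn_toLp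
  have hsymm := ContinuousLinearMap.isSelfAdjoint_iff_isSymmetric.1 hP.1.isSelfAdjoint
  -- Self-adjointness moves `P` onto the test function, where the `L_p` bound applies.
  have h1 : ∫ ω, P u ω * φ ω ∂μ = pairing μ u (P w) := by
    rw [← real_inner_Lp_two_eq_pairing, ← show inner ℝ (P u) w = inner ℝ u (P w) from hsymm u w,
      real_inner_Lp_two_eq_pairing]
    exact (pairing_congr (Filter.EventuallyEq.refl _ _) hwφ).symm
  have hwp : MemLp w p μ := (memLp_congr_ae hwφ).2 hφp
  have h2 := hP.2 w hwp
  rw [eLpNorm_congr_ae hwφ] at h2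
  have htop : ENNReal.ofReal C * eLpNorm φ p μ ≠ ∞ :=
    ENNReal.mul_ne_top ENNReal.ofReal_ne_top hφp.eLpNorm_ne_top
  have hPw : MemLp (P w) p μ := ⟨Lp.aestronglyMeasurable _, h2.trans_lt htop.lt_top⟩
  have h3 := ENNReal.toReal_mono htop h2
  rw [ENNReal.toReal_mul, ENNReal.toReal_ofReal hC] at h3
  rw [h1]
  calc |pairing μ u (P w)| ≤ (eLpNorm u q μ).toReal * (eLpNorm (P w) p μ).toReal :=
        abs_pairing_le hu hPw
    _ ≤ (eLpNorm u q μ).toReal * (C * (eLpNorm φ p μ).toReal) := by gcongr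
    _ = C * (eLpNorm u q μ).toReal * (eLpNorm φ p μ).toReal := by ring

variable [Fact (1 ≤ p)]

/-- A formal adjoint of a distributional embedding of a `C`-orthogonally complemented subspace is
bounded by `C`. -/
theorem IsFormalAdjoint.norm_le [p.HolderConjugate q] (hp : p ≠ ∞) (hq : q ≠ ∞)
    (hpq : p.toReal.HolderConjugate q.toReal) {C : ℝ} (hC : 0 ≤ C)
    {X : Submodule ℝ (Lp ℝ p μ)} (hX : IsOrthComplemented C X) {J : X →L[ℝ] Lp ℝ p μ}
    (hJ : IsDistEmbedding J) {S : Lp ℝ p μ →L[ℝ] X} (hS : IsFormalAdjoint q J S) : ‖S‖ ≤ C := by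
  obtain ⟨P, hP, hXP⟩ := hX
  refine S.opNorm_le_bound hC fun h => ?_
  change ‖(S h : Lp ℝ p μ)‖ ≤ _
  rw [Lp.norm_def]
  refine ENNReal.toReal_le_of_le_ofReal (by positivity)
    (eLpNorm_le_of_forall_integral_mul_le hq hp hpq.symm (Lp.stronglyMeasurable _).measurable
      (by positivity) fun φ hφ hb => ?_)
  have hφ2 := memLp_of_measurable_of_bounded (μ := μ) hφ hb 2
  have hφp := memLp_of_measurable_of_bounded (μ := μ) hφ hb p
  have hφq := memLp_of_measurable_of_bounded (μ := μ) hφ hb q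
  set u : Lp ℝ 2 μ := hφ2.toLp φ with hu
  have huφ : u =ᵐ[μ] φ := hφ2.coeFn_toLp
  have hup : MemLp u p μ := (memLp_congr_ae huφ).2 hφp
  have huq : MemLp u q μ := (memLp_congr_ae huφ).2 hφq
  have hPup : MemLp (P u) p μ := ⟨Lp.aestronglyMeasurable _, (hP.2 u hup).trans_lt
    (ENNReal.mul_lt_top ENNReal.ofReal_lt_top hup.eLpNorm_lt_top)⟩
  have hPle := hP.eLpNorm_conj_le hp hq hpq hC huq
  have htop : ENNReal.ofReal C * eLpNorm u q μ ≠ ∞ :=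
    ENNReal.mul_ne_top ENNReal.ofReal_ne_top huq.eLpNorm_ne_top
  have hPuq : MemLp (P u) q μ := ⟨Lp.aestronglyMeasurable _, hPle.trans_lt htop.lt_top⟩
  have hgX : hPup.toLp (P u) ∈ X := by
    rw [← SetLike.mem_coe, hXP]
    exact subset_closure ⟨u, hup, hPup.coeFn_toLp⟩
  -- The defining identity of `S` only tests against `X ∩ L_q`, so `φ` is replaced by `P φ`; pairing
  -- with elements of `X` does not see the change. Then `⟨S h, φ⟩ = ⟨J (P φ), h⟩`.
  set g : X := ⟨hPup.toLp (P u), hgX⟩ with hg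
  have hgP : (g : Lp ℝ p μ) =ᵐ[μ] P u := hPup.coeFn_toLp
  have hgq : MemLp (g : Lp ℝ p μ) q μ := (memLp_congr_ae hgP).2 hPuq
  have hid := hJ g
  have hJgq : MemLp (J g) q μ := hid.memLp_iff.2 hgq
  have hnorm : eLpNorm (J g) q μ = eLpNorm (P u) q μ := by
    rw [hid.eLpNorm_eq, eLpNorm_congr_ae hgP]
  have h1 : ∫ ω, (S h : Lp ℝ p μ) ω * φ ω ∂μ = pairing μ (J g) h := by
    rw [← hS h g hgq, pairing_congr hgP (Filter.EventuallyEq.refl _ _),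
      ← pairing_proj_eq hP.1 hXP huq hPuq (S h).2, pairing_comm]
    exact pairing_congr (Filter.EventuallyEq.refl _ _) huφ.symm
  have h3 := ENNReal.toReal_mono htop hPle
  rw [ENNReal.toReal_mul, ENNReal.toReal_ofReal hC, eLpNorm_congr_ae huφ] at h3
  rw [h1]
  calc |pairing μ (J g) h| ≤ (eLpNorm (J g) q μ).toReal * (eLpNorm h p μ).toReal :=
        abs_pairing_le hJgq (Lp.memLp h)
    _ ≤ C * (eLpNorm φ q μ).toReal * (eLpNorm h p μ).toReal := by rw [hnorm]; gcongr
    _ = C * ‖h‖ * (eLpNorm φ q μ).toReal := by rw [Lp.norm_def]; ring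

end Adjoint

/-! ### Factoring the identity -/

section Factor

/-- The Neumann series gives a two-sided inverse; its norm bound comes from `‖W x‖ ≥ (1 - ε) ‖x‖`.
-/
theorem exists_inverse_of_norm_sub_id_le {X : Type*} [NormedAddCommGroup X] [NormedSpace ℝ X]
    [CompleteSpace X] {ε : ℝ} (hε : ε < 1) {W : X →L[ℝ] X}
    (hW : ‖W - ContinuousLinearMap.id ℝ X‖ ≤ ε) :
    ∃ V : X →L[ℝ] X, V ∘L W = ContinuousLinearMap.id ℝ X ∧ ‖V‖ ≤ (1 - ε)⁻¹ := by
  have hlt : ‖1 - W‖ < 1 := by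
    rw [norm_sub_rev]; exact hW.trans_lt hε
  set u := Units.oneSub (1 - W) hlt with hu
  have huW : (u : X →L[ℝ] X) = W := by rw [hu, Units.val_oneSub, sub_sub_cancel]
  have hinv : ((u⁻¹ : (X →L[ℝ] X)ˣ) : X →L[ℝ] X) * W = 1 := by rw [← huW, Units.inv_mul]
  have hinv' : W * ((u⁻¹ : (X →L[ℝ] X)ˣ) : X →L[ℝ] X) = 1 := by rw [← huW, Units.mul_inv]
  refine ⟨_, hinv, ContinuousLinearMap.opNorm_le_bound _ (inv_nonneg.2 (by linarith)) fun y => ?_⟩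
  set x := ((u⁻¹ : (X →L[ℝ] X)ˣ) : X →L[ℝ] X) y with hx
  have hWx : W x = y := DFunLike.congr_fun hinv' y
  have h1 : ‖W x - x‖ ≤ ε * ‖x‖ := (W - ContinuousLinearMap.id ℝ X).le_of_opNorm_le hW x
  have h2 : ‖x‖ ≤ ‖W x‖ + ‖W x - x‖ := by
    calc ‖x‖ = ‖W x - (W x - x)‖ := by rw [sub_sub_cancel]
      _ ≤ _ := norm_sub_le _ _
  rw [hWx] at h1 h2
  rw [inv_mul_eq_div, le_div_iff₀ (by linarith)]
  linarith

variable {Ω : Type*} [MeasurableSpace Ω] {μ : Measure Ω} {p q : ℝ≥0∞} [Fact (1 ≤ p)]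

theorem isFormalAdjoint_formalAdjoint {Y : Submodule ℝ (Lp ℝ p μ)} {J : Y →L[ℝ] Lp ℝ p μ}
    (h : formalAdjoint q J ≠ 0) : IsFormalAdjoint q J (formalAdjoint q J) := by
  unfold formalAdjoint at h ⊢
  split_ifs with hex
  · exact hex.choose_spec
  · exact absurd (dif_neg hex) h

variable [IsProbabilityMeasure μ] {f : ℕ → Lp ℝ p μ}

theorem IsSymmThreeValuedMDS.ext_coordFn [p.HolderConjugate q] (hf : IsSymmThreeValuedMDS f)
    (hp : p ≠ ∞) (hpq : p.toReal.HolderConjugate q.toReal) {x y : closedSpan f}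
    (h : ∀ n, coordFn f n x = coordFn f n y) : x = y := by
  have hx := hf.tendsto_sum_coordFn hp hpq x
  simp only [h] at hx
  exact tendsto_nhds_unique hx (hf.tendsto_sum_coordFn hp hpq y)

/-- Coordinates determine an element of the closed span, so `R` fixes every `gen f n`, hence a dense
subspace. -/
theorem IsSymmThreeValuedMDS.eq_id_of_isDiagonal [p.HolderConjugate q]
    (hf : IsSymmThreeValuedMDS f) (hp : p ≠ ∞) (hpq : p.toReal.HolderConjugate q.toReal)
    {R : closedSpan f →L[ℝ] closedSpan f} (hR : IsDiagonal f R) (hR1 : ∀ n, diagEntry f R n = 1) :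
    R = ContinuousLinearMap.id ℝ (closedSpan f) := by
  have hgen : ∀ n, R (gen f n) = gen f n := fun n => hf.ext_coordFn hp hpq fun m => by
    rw [hf.coordFn_gen]
    split_ifs with h
    · rw [h]; exact hR1 n
    · exact hR m n h
  refine DFunLike.coe_injective ((denseRange_linearCombination_gen f).equalizer R.continuous
    (ContinuousLinearMap.id ℝ (closedSpan f)).continuous ?_)
  funext c
  simp only [Function.comp_apply, Finsupp.linearCombination_apply, Finsupp.sum, map_sum,
    map_smul, hgen, ContinuousLinearMap.id_apply]

theorem IsSymmThreeValuedMDS.isKFactor_id [p.HolderConjugate q] (hf : IsSymmThreeValuedMDS f)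
    (hp : p ≠ ∞) (hq : q ≠ ∞) (hpq : p.toReal.HolderConjugate q.toReal) {C : ℝ} (hC : 0 ≤ C)
    (hcompl : IsOrthComplemented C (closedSpan f))
    (hfactor : ∀ η : ℝ, 0 < η → ∀ T : closedSpan f →L[ℝ] closedSpan f,
      ∃ R : closedSpan f →L[ℝ] closedSpan f, IsDiagonal f R ∧
        (∀ n, diagEntry f R n ∈ convexHull ℝ (Set.range (diagEntry f T))) ∧
        IsOrthFactor q η T R)
    {ε : ℝ} (hε0 : 0 < ε) (hε1 : ε < 1) {δ : ℝ} (hδ : 0 < δ)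
    (T : closedSpan f →L[ℝ] closedSpan f) (hT : ∀ n, δ ≤ |diagEntry f T n|) :
    IsKFactor (C * (max p.toReal q.toReal - 1) * (1 - ε)⁻¹ * δ⁻¹) T
      (ContinuousLinearMap.id ℝ (closedSpan f)) := by
  have hd : ∀ n, diagEntry f T n ≠ 0 := fun n => abs_pos.1 (hδ.trans_le (hT n))
  obtain ⟨D, hD, hDnorm⟩ := hf.exists_multiplier hp hpq (inv_pos.2 hδ)
    (fun n => (diagEntry f T n)⁻¹) (fun n => by
      rw [abs_inv]; exact inv_anti₀ hδ (hT n))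
  -- Hypothesis (b) is applied to `T D` rather than `T`, with error equal to the `ε` of the final
  -- bound.
  obtain ⟨R, hRdiag, hRhull, J, hJX, hJ, hJR⟩ := hfactor ε hε0 (T ∘L D)
  have hdiag : ∀ n, diagEntry f (T ∘L D) n = 1 := fun n => by
    change coordFn f n (T (D (gen f n))) = 1
    rw [hD, map_smul, ← coordCLM_apply (q := q) hf, map_smul, coordCLM_apply, smul_eq_mul]
    exact inv_mul_cancel₀ (hd n)
  have hrange : Set.range (diagEntry f (T ∘L D)) = {1} := by
    rw [show diagEntry f (T ∘L D) = fun _ => 1 from funext hdiag, Set.range_const]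
  rw [hrange, convexHull_singleton] at hRhull
  rw [hf.eq_id_of_isDiagonal hp hpq hRdiag hRhull] at hJR
  have hgen0 : gen f 0 ≠ 0 := fun h => hf.ne_zero 0 (congrArg Subtype.val h)
  have : Nontrivial (closedSpan f) := ⟨⟨_, _, hgen0⟩⟩
  -- This rules out the default value without proving that adjoints exist: a zero adjoint would
  -- force `‖id‖ = 1 ≤ ε`.
  have hS0 : formalAdjoint q J ≠ 0 := by
    intro h0
    rw [h0, ContinuousLinearMap.zero_comp, zero_sub, ContinuousLinearMap.opNorm_neg,
      ContinuousLinearMap.norm_id] at hJR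
    linarith
  have hSnorm := (isFormalAdjoint_formalAdjoint hS0).norm_le hp hq hpq hC hcompl hJ
  set S := formalAdjoint q J
  set J' := J.codRestrict (closedSpan f) hJX with hJ'
  have hJ'norm : ‖J'‖ ≤ 1 := ContinuousLinearMap.opNorm_le_bound _ zero_le_one fun x => by
    rw [one_mul]; exact (hJ.norm_eq x).le
  obtain ⟨V, hV, hVnorm⟩ := exists_inverse_of_norm_sub_id_le hε1 hJR
  refine ⟨V ∘L S ∘L (closedSpan f).subtypeL, D ∘L J', hV.symm, ?_⟩
  have hA : ‖V ∘L S ∘L (closedSpan f).subtypeL‖ ≤ (1 - ε)⁻¹ * C := by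
    refine (ContinuousLinearMap.opNorm_comp_le _ _).trans ?_
    refine mul_le_mul hVnorm ?_ (ContinuousLinearMap.opNorm_nonneg _) (inv_nonneg.2 (by linarith))
    refine (ContinuousLinearMap.opNorm_comp_le _ _).trans ?_
    calc ‖S‖ * ‖(closedSpan f).subtypeL‖ ≤ C * 1 :=
          mul_le_mul hSnorm (Submodule.norm_subtypeL_le _) (ContinuousLinearMap.opNorm_nonneg _) hC
      _ = C := mul_one C
  have hB : ‖D ∘L J'‖ ≤ (max p.toReal q.toReal - 1) * δ⁻¹ := by
    refine (ContinuousLinearMap.opNorm_comp_le _ _).trans ?_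
    calc ‖D‖ * ‖J'‖ ≤ ‖D‖ * 1 := by gcongr
      _ ≤ _ := by rw [mul_one]; exact hDnorm
  calc _ ≤ ((1 - ε)⁻¹ * C) * ((max p.toReal q.toReal - 1) * δ⁻¹) :=
        mul_le_mul hA hB (ContinuousLinearMap.opNorm_nonneg _) ((ContinuousLinearMap.opNorm_nonneg _).trans hA)
    _ = _ := by ring

end Factor

theorem mainTheorem7 {Ω : Type*} [MeasurableSpace Ω] (μ : Measure Ω) [IsProbabilityMeasure μ]
    (p q : ℝ≥0∞) [Fact (1 ≤ p)] (hp : 1 < p) (hp' : p < ∞) (hpq : p.HolderConjugate q)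
    (f : ℕ → Lp ℝ p μ) (hf : IsSymmThreeValuedMDS f) (C : ℝ) (hC : 1 ≤ C)
    (hcompl : IsOrthComplemented C (closedSpan f))
    (hfactor : ∀ η : ℝ, 0 < η → ∀ T : closedSpan f →L[ℝ] closedSpan f,
      ∃ R : closedSpan f →L[ℝ] closedSpan f, IsDiagonal f R ∧
        (∀ n, diagEntry f R n ∈ convexHull ℝ (Set.range (diagEntry f T))) ∧
        IsOrthFactor q η T R) :
    (∀ ε : ℝ, 0 < ε → ε < 1 → ∀ δ : ℝ, 0 < δ → ∀ T : closedSpan f →L[ℝ] closedSpan f,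
      (∀ n, δ ≤ |diagEntry f T n|) →
        IsKFactor (C * (max p.toReal q.toReal - 1) * (1 - ε)⁻¹ * δ⁻¹) T
          (ContinuousLinearMap.id ℝ (closedSpan f))) ∧
    ∃ b : SchauderBasis ℝ (closedSpan f), (∀ n, b n = gen f n) ∧
      (∀ n x, b.coord n x = coordFn f n x) ∧ HasFactorizationProperty b := by
  have hpt : 1 < p.toReal := by
    rw [← ENNReal.toReal_one]
    exact (ENNReal.toReal_lt_toReal ENNReal.one_ne_top hp'.ne).2 hp
  have hpqr : p.toReal.HolderConjugate q.toReal := (ENNReal.HolderConjugate.toReal_iff hpt).2 hpq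
  have hq : q ≠ ∞ := fun h => by
    have := hpqr.symm.pos
    simp [h] at this
  have main := fun ε (h0 : 0 < ε) (h1 : ε < 1) δ (hδ : 0 < δ) =>
    hf.isKFactor_id hp'.ne hq hpqr (zero_le_one.trans hC) hcompl hfactor h0 h1 hδ
  refine ⟨main, mdsBasis hf hp'.ne hpqr, fun _ => rfl, fun _ _ => rfl, ?_⟩
  rintro T ⟨δ, hδ, hT⟩
  -- Any `ε` in `(0, 1)` serves, as the norm bound is discarded.
  obtain ⟨A, B, hAB, -⟩ := main (1 / 2) (by norm_num) (by norm_num) δ hδ T hT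
  exact ⟨A, B, hAB⟩
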